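/- Let $p$ be a prime, let $k=\mathbf F_q$ be a finite field of characteristic $p$ with Witt ring $W(k)=\mathbf Z_q$ and Frobenius $\sigma$, and let $d\ge 0$ be an integer. For $g\ge 0$ let $D=W(k)^{2g}$ and $W=D/pD=k^{2g}$ carry their standard symplectic forms $\omega$, and let $\mathrm{Sp}(W)=\mathrm{Sp}_{2g}(k)$. A $\sigma$-semilinear endomorphism $F$ of $D$ is $p$-autodual if there is a (unique) $\sigma^{-1}$-semilinear endomorphism $V$ of $D$ with $FV=VF=p$ and $\omega(Fx,y)=\sigma(\omega(x,Vy))$ for all $x,y\in D$. For every $g$ fix a $p$-autodual endomorphism $F_0$ of $D$, with reduction $\overline F_0$ modulo $p$. The random principally quasi-polarized (pqp) $\mathrm{DBT}_1$ of rank $2g$ is $(W,F,V,\omega)$, where $F=h_1\overline F_0h_2$ with $(h_1,h_2)$ uniformly distributed in $\mathrm{Sp}(W)\times\mathrm{Sp}(W)$, and $V$ is the $\sigma^{-1}$-semilinear map determined by $\omega(Fx,y)=\sigma(\omega(x,Vy))$; one has $\ker F=\mathrm{im}\,V$ and $\ker V=\mathrm{im}\,F$. The random pqp $\mathrm{BT}_1$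 of rank $2g$ is the finite commutative $k$-group scheme $G$ of $p$-power order, unique up to isomorphism, whose Dieudonné module $\mathrm{Hom}(G,CW)$ (homomorphisms from $G$ to Witt covectors, with the induced $k$-action, $F$ and $V$) is isomorphic to $(W,F,V)$. Let $E_g(d)$ be the expected number of surjective homomorphisms of $k$-group schemes from the random pqp $\mathrm{BT}_1$ of rank $2g$ to the constant group scheme $(\mathbf Z/p\mathbf Z)^d$. Then $$\lim_{g\to\infty}E_g(d)=1 .$$ -/

import Mathlib

open scoped TensorProduct Matrix
open Filter Topology

namespace RandomDieudonne

noncomputable section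

set_option linter.unusedSectionVars false

/-! ### Standard symplectic modules -/

/-- The free module `R^{2g}`. -/
abbrev Std (R : Type*) (g : ℕ) : Type _ := Fin g ⊕ Fin g → R

/-- The standard symplectic form on `R^{2g}`, with Gram matrix `Matrix.J`. -/
def omega {R : Type*} [CommRing R] {g : ℕ} (x y : Std R g) : R :=
  x ⬝ᵥ (Matrix.J (Fin g) R *ᵥ y)

/-- The group `Sp_{2g}(R)` of linear automorphisms of `R^{2g}` that preserve `omega`. -/
abbrev Sp (R : Type*) [CommRing R] (g : ℕ) : Type _ := Matrix.symplecticGroup (Fin g) R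

theorem omega_sum {R : Type*} [CommRing R] {g : ℕ} (x y : Std R g) :
    omega x y = ∑ i : Fin g, (x (Sum.inr i) * y (Sum.inl i) - x (Sum.inl i) * y (Sum.inr i)) := by
  have e : y = Sum.elim (y ∘ Sum.inl) (y ∘ Sum.inr) := (Sum.elim_comp_inl_inr y).symm
  rw [omega, Matrix.J, e, Matrix.fromBlocks_mulVec]
  simp [dotProduct, Matrix.neg_mulVec, Fintype.sum_sum_type, Finset.sum_sub_distrib]
  ring

theorem omega_mulVec {R : Type*} [CommRing R] {g : ℕ} (h : Sp R g) (x y : Std R g) :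
    omega (h.1 *ᵥ x) (h.1 *ᵥ y) = omega x y := by
  have hh := SymplecticGroup.mem_iff'.1 h.2
  unfold omega
  rw [Matrix.mulVec_mulVec, Matrix.dotProduct_mulVec, ← Matrix.vecMul_transpose,
    Matrix.vecMul_vecMul, ← Matrix.mul_assoc, hh, Matrix.dotProduct_mulVec]

section

variable (p : ℕ) [Fact p.Prime] (k : Type*) [Field k] [CharP k p] [PerfectRing k p] (g : ℕ)

/-! ### Dieudonné modules over `W(k)` and over `k` -/

/-- A pqp Dieudonné module structure `(F, V)` on `D = W(k)^{2g}` with its standard symplectic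
form; here `σ` is the Frobenius automorphism of the Witt ring `W(k)`. The map `F` is then
a `p`-autodual `σ`-endomorphism of `D`, and it determines `V`. -/
structure PqpDieudonne where
  F : Std (WittVector p k) g →ₛₗ[((WittVector.frobeniusEquiv p k : _ ≃+* _) :
    WittVector p k →+* WittVector p k)] Std (WittVector p k) g
  V : Std (WittVector p k) g →ₛₗ[((WittVector.frobeniusEquiv p k).symm :
    WittVector p k →+* WittVector p k)] Std (WittVector p k) g
  F_V : ∀ x, F (V x) = (p : WittVector p k) • x
  V_F : ∀ x, V (F x) = (p : WittVector p k) • x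
  omega_F : ∀ x y, omega (F x) y = WittVector.frobeniusEquiv p k (omega x (V y))

/-- A pqp `DBT_1` structure `(F, V)` on `W = k^{2g}` with its standard symplectic form. -/
@[ext]
structure PqpDBT1 where
  F : Std k g →ₛₗ[((frobeniusEquiv k p : k ≃+* k) : k →+* k)] Std k g
  V : Std k g →ₛₗ[((frobeniusEquiv k p).symm : k →+* k)] Std k g
  ker_V : ∀ y, V y = 0 ↔ ∃ x, F x = y
  ker_F : ∀ y, F y = 0 ↔ ∃ x, V x = y
  omega_F : ∀ x y, omega (F x) y = frobeniusEquiv k p (omega x (V y))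

end

section

variable {p : ℕ} [Fact p.Prime] {k : Type*} [Field k] [CharP k p] [PerfectRing k p] {g : ℕ}

/-- Reduction `D = W(k)^{2g} → W = k^{2g}` modulo `p`. -/
def red (x : Std (WittVector p k) g) : Std k g := fun i => WittVector.constantCoeff (x i)

/-- The Teichmüller lift `k^{2g} → W(k)^{2g}` (a set-theoretic section of `red`). -/
def lift (x : Std k g) : Std (WittVector p k) g := fun i => WittVector.teichmuller p (x i)

theorem red_lift (x : Std k g) : red (lift (p := p) x) = x := by
  funext i
  exact WittVector.teichmuller_coeff_zero p (x i)

theorem red_add (x y : Std (WittVector p k) g) : red (x + y) = red x + red y := by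
  funext i; simp only [red, Pi.add_apply, map_add]

theorem red_smul (c : WittVector p k) (x : Std (WittVector p k) g) :
    red (c • x) = WittVector.constantCoeff c • red x := by
  funext i; simp only [red, Pi.smul_apply, smul_eq_mul, map_mul]

theorem exists_of_red_eq (x y : Std (WittVector p k) g) (h : red x = red y) :
    ∃ z, x = y + (p : WittVector p k) • z := by
  have hk : ∀ i, ∃ z, x i - y i = (p : WittVector p k) * z := by
    intro i
    have : x i - y i ∈ RingHom.ker (WittVector.constantCoeff (p := p) (R := k)) := by
      rw [RingHom.mem_ker, map_sub, sub_eq_zero]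
      exact congrFun h i
    rw [WittVector.ker_constantCoeff, Ideal.mem_span_singleton] at this
    exact this
  choose z hz using hk
  refine ⟨z, funext fun i => ?_⟩
  simp [← hz i]

theorem coeff_zero_p : WittVector.constantCoeff (p : WittVector p k) = 0 := by
  rw [map_natCast]; exact CharP.cast_eq_zero k p

theorem red_p_smul (x : Std (WittVector p k) g) : red ((p : WittVector p k) • x) = 0 := by
  rw [red_smul, coeff_zero_p, zero_smul]

theorem constantCoeff_frob (c : WittVector p k) :
    WittVector.constantCoeff (((WittVector.frobeniusEquiv p k : _ ≃+* _) :
      WittVector p k →+* WittVector p k) c) =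
      ((frobeniusEquiv k p : k ≃+* k) : k →+* k) (WittVector.constantCoeff c) :=
  WittVector.coeff_frobenius_charP p c 0

theorem constantCoeff_frob_symm (c : WittVector p k) :
    WittVector.constantCoeff (((WittVector.frobeniusEquiv p k).symm :
      WittVector p k →+* WittVector p k) c) =
      ((frobeniusEquiv k p).symm : k →+* k) (WittVector.constantCoeff c) := by
  obtain ⟨c, rfl⟩ := (WittVector.frobeniusEquiv p k).surjective c
  have h := constantCoeff_frob (p := p) c
  simp only [RingHom.coe_coe, RingEquiv.symm_apply_apply] at h ⊢
  rw [h, RingEquiv.symm_apply_apply]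

theorem red_congr {τ : WittVector p k →+* WittVector p k}
    (f : Std (WittVector p k) g →ₛₗ[τ] Std (WittVector p k) g)
    {x y : Std (WittVector p k) g} (h : red x = red y) : red (f x) = red (f y) := by
  obtain ⟨z, rfl⟩ := exists_of_red_eq x y h
  rw [map_add, LinearMap.map_smulₛₗ, map_natCast, red_add, red_p_smul, add_zero]

/-- The reduction modulo `p` of a semilinear endomorphism of `W(k)^{2g}`; see `redMap_red`. -/
def redMap {τ : WittVector p k →+* WittVector p k} {t : k →+* k}
    (ht : ∀ c, WittVector.constantCoeff (τ c) = t (WittVector.constantCoeff c))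
    (f : Std (WittVector p k) g →ₛₗ[τ] Std (WittVector p k) g) : Std k g →ₛₗ[t] Std k g where
  toFun x := red (f (lift x))
  map_add' x y := by
    rw [← red_add, ← map_add]
    exact red_congr f (by rw [red_add, red_lift, red_lift, red_lift])
  map_smul' c x := by
    have h1 : red (lift (p := p) (c • x)) = red (WittVector.teichmuller p c • lift (p := p) x) := by
      rw [red_smul, red_lift, red_lift]
      exact congrArg (fun a : k => a • x) (WittVector.teichmuller_coeff_zero p c).symm
    rw [red_congr f h1, LinearMap.map_smulₛₗ, red_smul, ht]
    exact congrArg (fun a : k => t a • red (f (lift (p := p) x))) (WittVector.teichmuller_coeff_zero p c)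

theorem redMap_red {τ : WittVector p k →+* WittVector p k} {t : k →+* k}
    (ht : ∀ c, WittVector.constantCoeff (τ c) = t (WittVector.constantCoeff c))
    (f : Std (WittVector p k) g →ₛₗ[τ] Std (WittVector p k) g) (x : Std (WittVector p k) g) :
    redMap ht f (red x) = red (f x) :=
  red_congr f (red_lift _)

theorem omega_red (x y : Std (WittVector p k) g) :
    omega (red x) (red y) = WittVector.constantCoeff (omega x y) := by
  simp only [omega_sum, red, map_sum, map_sub, map_mul]

theorem p_smul_injective {x y : Std (WittVector p k) g}
    (h : (p : WittVector p k) • x = (p : WittVector p k) • y) : x = y :=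
  smul_right_injective _ (WittVector.p_nonzero p k) h

/-- The pqp `DBT_1` obtained by reducing a pqp Dieudonné module modulo `p`. -/
def PqpDieudonne.reduce (D : PqpDieudonne p k g) : PqpDBT1 p k g where
  F := redMap constantCoeff_frob D.F
  V := redMap constantCoeff_frob_symm D.V
  ker_V y := by
    constructor
    · intro h
      rw [← red_lift (p := p) y, redMap_red] at h
      obtain ⟨z, hz⟩ := exists_of_red_eq (D.V (lift y)) 0 (h.trans (by funext i; simp [red]))
      have h2 : lift y = D.F z := p_smul_injective <| by
        rw [← D.F_V, hz, zero_add, LinearMap.map_smulₛₗ, map_natCast]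
      exact ⟨red z, by rw [redMap_red, ← h2, red_lift]⟩
    · rintro ⟨x, rfl⟩
      rw [← red_lift (p := p) x, redMap_red, redMap_red, D.V_F, red_p_smul]
  ker_F y := by
    constructor
    · intro h
      rw [← red_lift (p := p) y, redMap_red] at h
      obtain ⟨z, hz⟩ := exists_of_red_eq (D.F (lift y)) 0 (h.trans (by funext i; simp [red]))
      have h2 : lift y = D.V z := p_smul_injective <| by
        rw [← D.V_F, hz, zero_add, LinearMap.map_smulₛₗ, map_natCast]
      exact ⟨red z, by rw [redMap_red, ← h2, red_lift]⟩
    · rintro ⟨x, rfl⟩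
      rw [← red_lift (p := p) x, redMap_red, redMap_red, D.F_V, red_p_smul]
  omega_F x y := by
    rw [← red_lift (p := p) x, ← red_lift (p := p) y, redMap_red, redMap_red, omega_red,
      omega_red, D.omega_F]
    exact constantCoeff_frob _

theorem mulVec_inv (h : Sp k g) (x : Std k g) : h.1 *ᵥ ((h⁻¹).1 *ᵥ x) = x := by
  rw [Matrix.mulVec_mulVec]
  have : h.1 * (h⁻¹).1 = 1 := congrArg Subtype.val (mul_inv_cancel h)
  rw [this, Matrix.one_mulVec]

theorem inv_mulVec (h : Sp k g) (x : Std k g) : (h⁻¹).1 *ᵥ (h.1 *ᵥ x) = x := by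
  rw [Matrix.mulVec_mulVec]
  have : (h⁻¹).1 * h.1 = 1 := congrArg Subtype.val (inv_mul_cancel h)
  rw [this, Matrix.one_mulVec]

/-- The `DBT_1` with Frobenius `h₁ F h₂`. Its Verschiebung is the adjoint `h₂⁻¹ V h₁⁻¹`. -/
def PqpDBT1.translate (M : PqpDBT1 p k g) (h₁ h₂ : Sp k g) : PqpDBT1 p k g where
  F := (Matrix.mulVecLin h₁.1).comp (M.F.comp (Matrix.mulVecLin h₂.1))
  V := (Matrix.mulVecLin (h₂⁻¹).1).comp (M.V.comp (Matrix.mulVecLin (h₁⁻¹).1))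
  ker_V y := by
    simp only [LinearMap.comp_apply, Matrix.mulVecLin_apply]
    constructor
    · intro h
      have h' : M.V ((h₁⁻¹).1 *ᵥ y) = 0 := by
        rw [← mulVec_inv h₂ (M.V _), h, Matrix.mulVec_zero]
      obtain ⟨x, hx⟩ := (M.ker_V _).1 h'
      exact ⟨(h₂⁻¹).1 *ᵥ x, by rw [mulVec_inv, hx, mulVec_inv]⟩
    · rintro ⟨x, rfl⟩
      rw [inv_mulVec, (M.ker_V _).2 ⟨_, rfl⟩, Matrix.mulVec_zero]
  ker_F y := by
    simp only [LinearMap.comp_apply, Matrix.mulVecLin_apply]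
    constructor
    · intro h
      have h' : M.F (h₂.1 *ᵥ y) = 0 := by
        rw [← inv_mulVec h₁ (M.F _), h, Matrix.mulVec_zero]
      obtain ⟨x, hx⟩ := (M.ker_F _).1 h'
      exact ⟨h₁.1 *ᵥ x, by rw [inv_mulVec, hx, inv_mulVec]⟩
    · rintro ⟨x, rfl⟩
      rw [mulVec_inv, (M.ker_F _).2 ⟨_, rfl⟩, Matrix.mulVec_zero]
  omega_F x y := by
    simp only [LinearMap.comp_apply, Matrix.mulVecLin_apply]
    rw [← omega_mulVec h₁⁻¹, inv_mulVec, M.omega_F, ← omega_mulVec h₂⁻¹, inv_mulVec]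

/-- The expected value of the statistic `X` of the random pqp `DBT_1` of rank `2g`: its Frobenius
is `h₁ F̄₀ h₂`, where `F̄₀` is the reduction of the fixed `p`-autodual endomorphism given by `D₀`
and `(h₁, h₂)` is uniformly distributed on `Sp_{2g}(k) × Sp_{2g}(k)`. -/
def expectation (D₀ : PqpDieudonne p k g) (X : PqpDBT1 p k g → ℝ) : ℝ :=
  (∑ᶠ h : Sp k g × Sp k g, X (D₀.reduce.translate h.1 h.2)) / Nat.card (Sp k g × Sp k g)

instance : Nonempty (PqpDieudonne p k g) := ⟨{
  F :=
    { toFun := fun x => Sum.elim (fun i => WittVector.frobeniusEquiv p k (x (Sum.inl i)))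
        (fun i => (p : WittVector p k) * WittVector.frobeniusEquiv p k (x (Sum.inr i)))
      map_add' := fun x y => by funext i; rcases i with i | i <;> simp [mul_add]
      map_smul' := fun c x => by funext i; rcases i with i | i <;> simp [mul_left_comm] }
  V :=
    { toFun := fun x => Sum.elim
        (fun i => (p : WittVector p k) * (WittVector.frobeniusEquiv p k).symm (x (Sum.inl i)))
        (fun i => (WittVector.frobeniusEquiv p k).symm (x (Sum.inr i)))
      map_add' := fun x y => by funext i; rcases i with i | i <;> simp [mul_add]
      map_smul' := fun c x => by funext i; rcases i with i | i <;> simp [mul_left_comm] }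
  F_V := fun x => by
    funext i
    rcases i with i | i <;> simp [-WittVector.frobeniusEquiv_apply,
      -WittVector.frobeniusEquiv_symm_apply]
  V_F := fun x => by
    funext i
    rcases i with i | i <;> simp [-WittVector.frobeniusEquiv_apply,
      -WittVector.frobeniusEquiv_symm_apply]
  omega_F := fun x y => by
    simp only [omega_sum, map_sum]
    refine Finset.sum_congr rfl fun i _ => ?_
    simp [-WittVector.frobeniusEquiv_apply, -WittVector.frobeniusEquiv_symm_apply]
    ring }⟩

end

/-! ### Finite group schemes and their Dieudonné modules -/

/-- A finite commutative group scheme of `p`-power order over the field `k`, given by its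
coordinate ring, a finite commutative and cocommutative Hopf algebra. -/
structure FinGroupScheme (p : ℕ) (k : Type*) [Field k] : Type _ where
  coord : Type*
  [commRing : CommRing coord]
  [hopf : HopfAlgebra k coord]
  [cocomm : Coalgebra.IsCocomm k coord]
  [finite : Module.Finite k coord]
  order : ∃ v : ℕ, Module.finrank k coord = p ^ v

attribute [instance] FinGroupScheme.commRing FinGroupScheme.hopf FinGroupScheme.cocomm
  FinGroupScheme.finite

/-- The sequence `a`, where `a n` stands for the entry of index `-n`, is a Witt covector
`(…, a₋₂, a₋₁, a₀)`: some tail `a₋ᵣ, a₋ᵣ₋₁, …` generates a nilpotent ideal. -/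
def IsCovector {A : Type*} [CommRing A] (a : ℕ → A) : Prop :=
  ∃ r : ℕ, IsNilpotent (Ideal.span (a '' Set.Ici r))

/-- The Witt vector `(a₋ₙ, …, a₋₁, a₀, a₀, a₀, …)`. Only its entries of index at most `N` matter
below. -/
def wittOfCovector (p : ℕ) {A : Type*} (a : ℕ → A) (N : ℕ) : WittVector p A :=
  WittVector.mk p fun i => a (N - i)

/-- `c` is the sum of the Witt covectors `a` and `b`: for every `n`, the entry `c₋ₙ` is the
eventual value, as `m` grows, of the Witt addition polynomial
`S_m(a₋ₙ₋ₘ, …, a₋ₙ; b₋ₙ₋ₘ, …, b₋ₙ)`. -/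
def IsCovectorSum (p : ℕ) [Fact p.Prime] {A : Type*} [CommRing A] (a b c : ℕ → A) : Prop :=
  ∀ n, ∀ᶠ m : ℕ in atTop,
    (wittOfCovector p a (n + m) + wittOfCovector p b (n + m)).coeff m = c n

/-- The covector `a` over the coordinate ring of `G` is, as a morphism from `G` to the group
functor `CW` of Witt covectors, a homomorphism of groups. -/
def FinGroupScheme.IsCovectorHom {p : ℕ} [Fact p.Prime] {k : Type*} [Field k]
    (G : FinGroupScheme p k) (a : ℕ → G.coord) : Prop :=
  IsCovector a ∧
    IsCovectorSum p (fun n => a n ⊗ₜ[k] (1 : G.coord)) (fun n => (1 : G.coord) ⊗ₜ[k] a n)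
      (fun n => Coalgebra.comul (R := k) (a n))

/-- An isomorphism of the pqp `DBT_1` `M` with the Dieudonné module `Hom(G, CW)` of `G`.
On covectors, `F` raises every entry to the `p`-th power, `V` is the shift
`(…, a₋₁, a₀) ↦ (…, a₋₂, a₋₁)`, and the Teichmüller representative of `c ∈ k` multiplies `a₋ₙ` by
the `pⁿ`-th root of `c`. (As `M` is killed by `p`, equivariance for Teichmüller representatives is
`W(k)`-linearity.) -/
structure DieudonneIso {p : ℕ} [Fact p.Prime] {k : Type*} [Field k] [CharP k p] [PerfectRing k p]
    {g : ℕ} (G : FinGroupScheme p k) (M : PqpDBT1 p k g) where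
  toFun : Std k g → ℕ → G.coord
  injective : Function.Injective toFun
  range_eq : Set.range toFun = {a | G.IsCovectorHom a}
  map_add : ∀ x y, IsCovectorSum p (toFun x) (toFun y) (toFun (x + y))
  map_smul : ∀ (c : k) x n,
    toFun (c • x) n = ((iterateFrobeniusEquiv k p n).symm c) • toFun x n
  map_F : ∀ x n, toFun (M.F x) n = toFun x n ^ p
  map_V : ∀ x n, toFun (M.V x) n = toFun x (n + 1)

/-- A homomorphism from `G` to the constant group scheme attached to the finite group `Γ`, whose
coordinate ring is `Γ → k` with comultiplication `δ_γ ↦ ∑_{α + β = γ} δ_α ⊗ δ_β`. -/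
structure FinGroupScheme.HomToConst {p : ℕ} {k : Type*} [Field k] (G : FinGroupScheme p k)
    (Γ : Type*) [AddCommGroup Γ] [Fintype Γ] [DecidableEq Γ] where
  toAlgHom : (Γ → k) →ₐ[k] G.coord
  comul_single : ∀ γ : Γ, Coalgebra.comul (R := k) (toAlgHom (Pi.single γ 1)) =
    ∑ α : Γ, toAlgHom (Pi.single α 1) ⊗ₜ[k] toAlgHom (Pi.single (γ - α) 1)

/-- The number of surjective homomorphisms from `G` to the constant group scheme `(ℤ/pℤ)^d`. -/
def FinGroupScheme.numSurj {p : ℕ} [Fact p.Prime] {k : Type*} [Field k] (G : FinGroupScheme p k)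
    (d : ℕ) : ℕ :=
  Nat.card {φ : G.HomToConst (Fin d → ZMod p) //
    Function.Surjective (PrimeSpectrum.comap φ.toAlgHom.toRingHom)}

end

end RandomDieudonne

/-! A surjection from `G` to `(ℤ/p)^d` is a `d`-tuple of characters of `G` (primitive functions `f`
with `f ^ p = f`) that is linearly independent over `k` (`numSurj_eq_card`). A vector with `F x = x`
lies in `im F = ker V`, so its covector is concentrated in degree `0`, and its one nonzero entry is
such a character. Hence the number of surjections is the number of linearly independent `d`-tuples
fixed by `F` (`DieudonneIso.numSurj_eq`).

For `F = h₁ F̄₀ h₂`, conjugation by `h₂` reduces to `h F̄₀` with `h` uniform in `Sp`. A tuple `y`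
fixed by `h F̄₀` is isotropic, because `im F̄₀` is, and `F̄₀ y` is again an isotropic frame. By
Witt's theorem (`IsIsotropicFrame.exists_sp_map`) a random `h` takes `F̄₀ y` to `y` with probability
one over the number of isotropic frames. The expectation is therefore exactly the probability that a
random isotropic `d`-frame stays independent under `F̄₀`.

If it does not, one of at most `q^d` nontrivial combinations of the frame falls in `ker F̄₀`. Each
such combination is a uniform nonzero vector and `ker F̄₀` is isotropic, so this has probability at
most `(q^g - 1)/(q^{2g} - 1) = 1/(q^g + 1)`. The expectation lies between `1 - q^d/(q^g + 1)` and
`1`. -/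

namespace RandomDieudonne

set_option linter.unusedSectionVars false

/-! ### Symplectic linear algebra: Witt transitivity on isotropic frames. -/

section Symplectic

variable {k : Type*} [Field k] {g : ℕ}

/-- The symplectic form `omega` as a bilinear form. -/
noncomputable def omegaForm (k : Type*) [Field k] (g : ℕ) : LinearMap.BilinForm k (Std k g) :=
  Matrix.toBilin' (Matrix.J (Fin g) k)

theorem omegaForm_apply (x y : Std k g) : omegaForm k g x y = omega x y :=
  Matrix.toBilin'_apply' _ _ _

theorem omega_swap (x y : Std k g) : omega x y = -omega y x := by
  simp only [omega_sum, ← Finset.sum_neg_distrib]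
  exact Finset.sum_congr rfl fun i _ => by ring

theorem omega_self (x : Std k g) : omega x x = 0 := by
  rw [omega_sum]
  exact Finset.sum_eq_zero fun i _ => by ring

theorem omegaForm_nondegenerate : (omegaForm k g).Nondegenerate := by
  unfold omegaForm
  rw [Matrix.nondegenerate_toBilin'_iff]
  exact Matrix.nondegenerate_of_det_ne_zero (Matrix.isUnit_det_J (Fin g) k).ne_zero

theorem omega_add_left (x y z : Std k g) : omega (x + y) z = omega x z + omega y z := by
  simp only [← omegaForm_apply, map_add, LinearMap.add_apply]

theorem omega_add_right (x y z : Std k g) : omega x (y + z) = omega x y + omega x z := by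
  simp only [← omegaForm_apply, map_add]

theorem omega_sub_right (x y z : Std k g) : omega x (y - z) = omega x y - omega x z := by
  simp only [← omegaForm_apply, map_sub]

theorem omega_smul_left (c : k) (x z : Std k g) : omega (c • x) z = c * omega x z := by
  simp only [← omegaForm_apply, map_smul, LinearMap.smul_apply, smul_eq_mul]

theorem omega_smul_right (c : k) (x z : Std k g) : omega x (c • z) = c * omega x z := by
  simp only [← omegaForm_apply, map_smul, smul_eq_mul]

theorem omega_zero_left (x : Std k g) : omega 0 x = 0 := by
  simp only [← omegaForm_apply, map_zero, LinearMap.zero_apply]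

theorem omega_zero_right (x : Std k g) : omega x 0 = 0 := by
  simp only [← omegaForm_apply, map_zero]

theorem omega_single_single (i j : Fin g ⊕ Fin g) :
    omega (Pi.single i (1 : k)) (Pi.single j 1) = Matrix.J (Fin g) k i j := by
  simp [omega]

/-- A linear endomorphism that preserves `omega` is given by a symplectic matrix. -/
theorem exists_sp_of_preserves (T : Std k g →ₗ[k] Std k g)
    (hT : ∀ x y, omega (T x) (T y) = omega x y) : ∃ h : Sp k g, ∀ x, h.1 *ᵥ x = T x := by
  refine ⟨⟨LinearMap.toMatrix' T, SymplecticGroup.mem_iff'.2 ?_⟩, fun x => ?_⟩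
  · have key : ∀ x y : Std k g,
        x ⬝ᵥ (((LinearMap.toMatrix' T)ᵀ * Matrix.J (Fin g) k * LinearMap.toMatrix' T) *ᵥ y) =
          x ⬝ᵥ (Matrix.J (Fin g) k *ᵥ y) := by
      intro x y
      have h := hT x y
      unfold omega at h
      rw [← h, ← LinearMap.toMatrix'_mulVec T x, ← LinearMap.toMatrix'_mulVec T y,
        ← Matrix.vecMul_transpose _ x, ← Matrix.dotProduct_mulVec, Matrix.mulVec_mulVec,
        Matrix.mulVec_mulVec, Matrix.mul_assoc]
    ext i j
    simpa using key (Pi.single i 1) (Pi.single j 1)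
  · exact LinearMap.toMatrix'_mulVec T x

/-- The symplectic transvection `w ↦ w + a ω(w, v) v`. -/
theorem exists_transvection (a : k) (v : Std k g) :
    ∃ h : Sp k g, ∀ w, h.1 *ᵥ w = w + (a * omega w v) • v := by
  obtain ⟨h, hh⟩ := exists_sp_of_preserves
    (LinearMap.id + a • ((omegaForm k g).flip v).smulRight v) (by
      intro x y
      simp only [LinearMap.add_apply, LinearMap.id_apply, LinearMap.smul_apply,
        LinearMap.smulRight_apply, LinearMap.BilinForm.flip_apply, omegaForm_apply, omega_add_left,
        omega_add_right, omega_smul_left, omega_smul_right, omega_self]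
      rw [omega_swap v y]
      ring)
  refine ⟨h, fun w => ?_⟩
  rw [hh]
  simp [LinearMap.BilinForm.flip_apply, omegaForm_apply, mul_smul]

/-- A vector outside a subspace is detected by a vector orthogonal to the subspace. -/
theorem exists_omega_ne_zero {x : Std k g} {U : Submodule k (Std k g)} (hx : x ∉ U) :
    ∃ z, (∀ u ∈ U, omega u z = 0) ∧ omega x z ≠ 0 := by
  obtain ⟨f, hf, hU⟩ := Submodule.exists_le_ker_of_notMem hx
  obtain ⟨z, hz⟩ := ((omegaForm k g).flip.toDual omegaForm_nondegenerate.flip).surjective f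
  have h : ∀ w, omega w z = f w := fun w => by
    rw [← hz, LinearMap.BilinForm.toDual_def, LinearMap.BilinForm.flip_apply, omegaForm_apply]
  exact ⟨z, fun u hu => by rw [h]; exact hU hu, by rwa [h]⟩

/-- Two vectors outside a subspace `U` that pair in the same way with `U` are exchanged by a
symplectic automorphism fixing `U` pointwise. -/
theorem exists_sp_fixing_map {x y : Std k g} {U : Submodule k (Std k g)} (hx : x ∉ U) (hy : y ∉ U)
    (hxy : ∀ u ∈ U, omega u x = omega u y) :
    ∃ h : Sp k g, (∀ u ∈ U, h.1 *ᵥ u = u) ∧ h.1 *ᵥ x = y := by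
  -- If `ω(x, y) ≠ 0`, one transvection along `y - x` suffices: it fixes `U` because `y - x` is
  -- orthogonal to `U`, and the factor `ω(x, y)⁻¹` makes it take `x` to `y`.
  have step : ∀ x y : Std k g, (∀ u ∈ U, omega u x = omega u y) → omega x y ≠ 0 →
      ∃ h : Sp k g, (∀ u ∈ U, h.1 *ᵥ u = u) ∧ h.1 *ᵥ x = y := by
    intro x y hxy hne
    obtain ⟨h, hh⟩ := exists_transvection (omega x y)⁻¹ (y - x)
    refine ⟨h, fun u hu => ?_, ?_⟩
    · rw [hh, omega_sub_right, hxy u hu]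
      simp
    · rw [hh, omega_sub_right, omega_self, sub_zero, inv_mul_cancel₀ hne, one_smul]
      abel
  -- If `ω(x, y) = 0`, the path goes through `x + z`, where `z ∈ U^⊥` pairs nontrivially with both
  -- `x` and `y`. If neither of two vectors detecting `x` and `y` separately works for both, their
  -- sum does.
  obtain ⟨z, hzU, hz⟩ : ∃ z, (∀ u ∈ U, omega u z = 0) ∧ omega x z ≠ 0 ∧ omega y z ≠ 0 := by
    obtain ⟨z₁, h₁, hx₁⟩ := exists_omega_ne_zero hx
    obtain ⟨z₂, h₂, hy₂⟩ := exists_omega_ne_zero hy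
    by_cases hy₁ : omega y z₁ = 0
    · by_cases hx₂ : omega x z₂ = 0
      · exact ⟨z₁ + z₂, fun u hu => by rw [omega_add_right, h₁ u hu, h₂ u hu, add_zero],
          by rwa [omega_add_right, hx₂, add_zero], by rwa [omega_add_right, hy₁, zero_add]⟩
      · exact ⟨z₂, h₂, hx₂, hy₂⟩
    · exact ⟨z₁, h₁, hx₁, hy₁⟩
  by_cases hne : omega x y = 0
  · obtain ⟨a, ha, hax⟩ := step x (x + z) (fun u hu => by rw [omega_add_right, hzU u hu, add_zero])
      (by rw [omega_add_right, omega_self, zero_add]; exact hz.1)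
    obtain ⟨b, hb, hby⟩ := step (x + z) y
      (fun u hu => by rw [omega_add_right, hzU u hu, add_zero, hxy u hu])
      (by rw [omega_add_left, hne, zero_add, omega_swap, neg_ne_zero]; exact hz.2)
    refine ⟨b * a, fun u hu => ?_, ?_⟩
    · rw [Submonoid.coe_mul, ← Matrix.mulVec_mulVec, ha u hu, hb u hu]
    · rw [Submonoid.coe_mul, ← Matrix.mulVec_mulVec, hax, hby]
  · exact step x y hxy hne

/-- A linearly independent family spanning an isotropic subspace. -/
def IsIsotropicFrame {d : ℕ} (x : Fin d → Std k g) : Prop :=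
  LinearIndependent k x ∧ ∀ i j, omega (x i) (x j) = 0

theorem IsIsotropicFrame.mulVec {d : ℕ} {x : Fin d → Std k g} (hx : IsIsotropicFrame x)
    (h : Sp k g) : IsIsotropicFrame fun i => h.1 *ᵥ x i := by
  refine ⟨?_, fun i j => by rw [omega_mulVec, hx.2]⟩
  refine hx.1.map' (Matrix.mulVecLin h.1) (LinearMap.ker_eq_bot.2 fun a b hab => ?_)
  have := congrArg (fun v => (h⁻¹).1 *ᵥ v) hab
  have e : (h⁻¹).1 * h.1 = 1 := congrArg Subtype.val (inv_mul_cancel h)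
  simpa [Matrix.mulVec_mulVec, e] using this

/-- The symplectic group is transitive on isotropic frames. -/
theorem IsIsotropicFrame.exists_sp_map {d : ℕ} {x y : Fin d → Std k g} (hx : IsIsotropicFrame x)
    (hy : IsIsotropicFrame y) : ∃ h : Sp k g, ∀ i, h.1 *ᵥ x i = y i := by
  induction d with
  | zero => exact ⟨1, fun i => i.elim0⟩
  | succ d ih =>
    have tail : ∀ {z : Fin (d + 1) → Std k g}, IsIsotropicFrame z →
        IsIsotropicFrame fun i : Fin d => z i.succ := fun hz =>
      ⟨hz.1.comp _ (Fin.succ_injective d), fun i j => hz.2 _ _⟩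
    obtain ⟨a, ha⟩ := ih (tail hx) (tail hy)
    have hax := hx.mulVec a
    have hnot : ∀ {z : Fin (d + 1) → Std k g}, IsIsotropicFrame z →
        z 0 ∉ Submodule.span k (Set.range fun i : Fin d => z i.succ) := fun {z} hz =>
      (linearIndependent_finSucc.1 hz.1).2
    have hU : ∀ {z : Fin (d + 1) → Std k g}, IsIsotropicFrame z →
        ∀ u ∈ Submodule.span k (Set.range fun i : Fin d => z i.succ), omega u (z 0) = 0 := by
      intro z hz u hu
      induction hu using Submodule.span_induction with
      | mem u hu => obtain ⟨i, rfl⟩ := hu; exact hz.2 _ _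
      | zero => exact omega_zero_left _
      | add u v _ _ hu hv => rw [omega_add_left, hu, hv, add_zero]
      | smul c u _ hu => rw [omega_smul_left, hu, mul_zero]
    have e : (fun i : Fin d => a.1 *ᵥ x i.succ) = fun i => y i.succ := funext ha
    have h₁ := hnot hax
    have h₂ := hU hax
    simp only [e] at h₁ h₂
    -- Once the tails agree, the two first vectors lie outside the span of the common tail and are
    -- orthogonal to it, so one can be moved to the other while the tail stays fixed.
    obtain ⟨b, hb, hb0⟩ := exists_sp_fixing_map h₁ (hnot hy)
      (fun u hu => by rw [h₂ u hu, hU hy u hu])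
    refine ⟨b * a, fun i => ?_⟩
    rw [Submonoid.coe_mul, ← Matrix.mulVec_mulVec]
    refine Fin.cases hb0 (fun i => ?_) i
    rw [ha]
    exact hb _ (Submodule.subset_span ⟨i, rfl⟩)

/-- The symplectic group is transitive on nonzero vectors. -/
theorem exists_sp_map_of_ne_zero {x y : Std k g} (hx : x ≠ 0) (hy : y ≠ 0) :
    ∃ h : Sp k g, h.1 *ᵥ x = y := by
  obtain ⟨h, -, hh⟩ := exists_sp_fixing_map (U := ⊥) (by simpa using hx) (by simpa using hy)
    (fun u hu => by rw [(Submodule.mem_bot k).1 hu, omega_zero_left, omega_zero_left])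
  exact ⟨h, hh⟩

theorem exists_isIsotropicFrame {d : ℕ} (h : d ≤ g) :
    ∃ x : Fin d → Std k g, IsIsotropicFrame x := by
  refine ⟨fun i => Pi.single (Sum.inl (Fin.castLE h i)) 1, ?_, fun i j => ?_⟩
  · have := (Pi.basisFun k (Fin g ⊕ Fin g)).linearIndependent.comp
      (fun i : Fin d => Sum.inl (Fin.castLE h i))
      (Sum.inl_injective.comp (Fin.castLE_injective h))
    convert this using 1
    funext i
    simp
  · rw [omega_single_single]
    simp [Matrix.J]

/-- An isotropic subspace has at most half the dimension. -/
theorem two_mul_finrank_le_of_isotropic (L : Submodule k (Std k g))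
    (hL : ∀ x ∈ L, ∀ y ∈ L, omega x y = 0) : 2 * Module.finrank k L ≤ 2 * g := by
  have h := LinearMap.BilinForm.finrank_orthogonal omegaForm_nondegenerate L
  have hle : L ≤ (omegaForm k g).orthogonal L := fun x hx => by
    rw [LinearMap.BilinForm.mem_orthogonal_iff]
    intro y hy
    rw [omegaForm_apply]
    exact hL y hy x hx
  have h1 := Submodule.finrank_mono hle
  have h2 : Module.finrank k (Std k g) = 2 * g := by simp [two_mul]
  have h3 := Submodule.finrank_le L
  omega

end Symplectic

/-! ### Lagrange idempotents for elements with `f ^ p = f`. -/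

section Lagrange

variable {p : ℕ} [Fact p.Prime] {A : Type*} [CommRing A] (r : ZMod p →+* A) {d : ℕ}

/-- The indicator function `1 - (f - c)^{p-1}` of the point `c ∈ ℤ/p`, evaluated at `f`. -/
def indicator (f : A) (c : ZMod p) : A := 1 - (f - r c) ^ (p - 1)

/-- The indicator function of `γ ∈ (ℤ/p)^d`, evaluated at `f`. -/
def multiIndicator (f : Fin d → A) (γ : Fin d → ZMod p) : A := ∏ i, indicator r (f i) (γ i)

theorem map_multiIndicator {B : Type*} [CommRing B] (s : A →+* B) (f : Fin d → A)
    (γ : Fin d → ZMod p) :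
    s (multiIndicator r f γ) = multiIndicator (s.comp r) (fun i => s (f i)) γ := by
  simp [multiIndicator, indicator, map_prod]

/-- In `𝔽_p[X]`, `(X - c)(1 - (X - c)^{p-1}) = X - X^p`, since `(X - c)^p = X^p - c`. This vanishes
at `f`. -/
theorem mul_indicator {f : A} (hf : f ^ p = f) (c : ZMod p) :
    f * indicator r f c = r c * indicator r f c := by
  have hp : p = p - 1 + 1 := (Nat.sub_add_cancel (Fact.out : p.Prime).one_le).symm
  have h : (Polynomial.X - Polynomial.C c) * (1 - (Polynomial.X - Polynomial.C c) ^ (p - 1)) =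
      (Polynomial.X : Polynomial (ZMod p)) - Polynomial.X ^ p := by
    rw [mul_sub, mul_one, ← pow_succ', ← hp, sub_pow_char, ← Polynomial.C_pow, ZMod.pow_card]
    ring
  have := congrArg (Polynomial.eval₂ r f) h
  simp only [Polynomial.eval₂_mul, Polynomial.eval₂_sub, Polynomial.eval₂_X, Polynomial.eval₂_C,
    Polynomial.eval₂_pow, Polynomial.eval₂_one, hf, sub_self] at this
  rw [← sub_eq_zero, ← sub_mul]
  exact this

/-- A polynomial identity over `𝔽_p`: the difference of the two sides has degree below `p` and
vanishes at all `p` points. -/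
theorem sum_indicator (f : A) : ∑ c : ZMod p, indicator r f c = 1 := by
  have hp := (Fact.out : p.Prime)
  have h : ∑ c : ZMod p, (1 - ((Polynomial.X : Polynomial (ZMod p)) - Polynomial.C c) ^ (p - 1)) -
      1 = 0 := by
    refine Polynomial.eq_zero_of_natDegree_lt_card_of_eval_eq_zero (f := id) _
      Function.injective_id (fun a => ?_) ?_
    · rw [Polynomial.eval_sub, Polynomial.eval_finsetSum, Finset.sum_eq_single a]
      · simp [Nat.sub_ne_zero_of_lt hp.one_lt]
      · intro c _ hc
        simp [ZMod.pow_card_sub_one_eq_one (sub_ne_zero.2 hc.symm)]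
      · simp
    · rw [ZMod.card]
      refine lt_of_le_of_lt ?_ (Nat.sub_lt hp.pos one_pos)
      refine (Polynomial.natDegree_sub_le _ _).trans (max_le
        (Polynomial.natDegree_sum_le_of_forall_le _ _ fun c _ => ?_)
        (Polynomial.natDegree_one.trans_le (Nat.zero_le _)))
      refine (Polynomial.natDegree_sub_le _ _).trans (max_le
        (Polynomial.natDegree_one.trans_le (Nat.zero_le _)) ?_)
      exact (Polynomial.natDegree_pow_le).trans (by simp)
  have := congrArg (Polynomial.eval₂ r f) h
  simp only [Polynomial.eval₂_sub, Polynomial.eval₂_finsetSum, Polynomial.eval₂_X,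
    Polynomial.eval₂_C, Polynomial.eval₂_pow, Polynomial.eval₂_one, Polynomial.eval₂_zero] at this
  exact sub_eq_zero.1 this

theorem mul_multiIndicator {f : Fin d → A} (hf : ∀ i, f i ^ p = f i) (i : Fin d)
    (γ : Fin d → ZMod p) : f i * multiIndicator r f γ = r (γ i) * multiIndicator r f γ := by
  unfold multiIndicator
  rw [← Finset.mul_prod_erase _ _ (Finset.mem_univ i), ← mul_assoc, mul_indicator r (hf i),
    mul_assoc]

theorem sum_multiIndicator (f : Fin d → A) : ∑ γ : Fin d → ZMod p, multiIndicator r f γ = 1 := by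
  have h := Finset.prod_univ_sum (fun _ : Fin d => (Finset.univ : Finset (ZMod p)))
    (fun i c => indicator r (f i) c)
  simp only [sum_indicator, Finset.prod_const_one, Fintype.piFinset_univ] at h
  exact h.symm

/-- Joint eigenvectors with different eigenvalues in `(ℤ/p)^d` are orthogonal. -/
theorem eigen_mul_eq_zero {f : Fin d → A} {γ δ : Fin d → ZMod p} {a b : A}
    (ha : ∀ i, f i * a = r (γ i) * a) (hb : ∀ i, f i * b = r (δ i) * b) (h : γ ≠ δ) :
    a * b = 0 := by
  obtain ⟨i, hi⟩ := Function.ne_iff.1 h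
  have h1 : r (γ i - δ i) * (a * b) = 0 := by
    rw [map_sub]
    linear_combination b * (-ha i) + a * hb i
  have h2 : r ((γ i - δ i)⁻¹) * r (γ i - δ i) = 1 := by
    rw [← map_mul, inv_mul_cancel₀ (sub_ne_zero.2 hi), map_one]
  linear_combination r ((γ i - δ i)⁻¹) * h1 - a * b * h2

/-- A partition of unity into joint eigenvectors consists of the indicators. -/
theorem eq_multiIndicator {f : Fin d → A} (hf : ∀ i, f i ^ p = f i)
    {R : (Fin d → ZMod p) → A} (hR : ∀ i γ, f i * R γ = r (γ i) * R γ) (hsum : ∑ γ, R γ = 1)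
    (γ : Fin d → ZMod p) : R γ = multiIndicator r f γ := by
  have h1 : R γ = multiIndicator r f γ * R γ := by
    conv_lhs => rw [← one_mul (R γ), ← sum_multiIndicator r f, Finset.sum_mul]
    refine Finset.sum_eq_single γ (fun δ _ hδ => ?_) (by simp)
    exact eigen_mul_eq_zero r (fun i => mul_multiIndicator r hf i δ) (fun i => hR i γ) hδ
  have h2 : multiIndicator r f γ = multiIndicator r f γ * R γ := by
    conv_lhs => rw [← mul_one (multiIndicator r f γ), ← hsum, Finset.mul_sum]
    refine Finset.sum_eq_single γ (fun δ _ hδ => ?_) (by simp)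
    exact eigen_mul_eq_zero r (fun i => mul_multiIndicator r hf i γ) (fun i => hR i δ) hδ.symm
  rw [h1, ← h2]

end Lagrange

/-! ### Homomorphisms to `(ℤ/p)^d` as tuples of characters; surjectivity as linear independence. -/

section HomToConst

variable {p : ℕ} [Fact p.Prime] {k : Type*} [Field k] [CharP k p] {d : ℕ}

/-- The prime field inside a `k`-algebra. -/
noncomputable def primeField (p : ℕ) (k : Type*) [Field k] [CharP k p] (A : Type*) [CommRing A]
    [Algebra k A] : ZMod p →+* A :=
  (algebraMap k A).comp (ZMod.castHom (dvd_refl p) k)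

/-- The coordinate functions on `(ℤ/p)^d`. -/
noncomputable def coordFun (p : ℕ) (k : Type*) [Field k] [CharP k p] {d : ℕ} (i : Fin d) :
    (Fin d → ZMod p) → k :=
  fun γ => ZMod.castHom (dvd_refl p) k (γ i)

theorem coordFun_mul_single (i : Fin d) (γ : Fin d → ZMod p) :
    coordFun p k i * Pi.single γ (1 : k) =
      primeField p k _ (γ i) * Pi.single γ 1 := by
  funext δ
  by_cases h : δ = γ
  · subst h; simp [coordFun, primeField, Pi.mul_apply]
  · simp [Pi.single_eq_of_ne h]

theorem coordFun_pow (i : Fin d) : coordFun p k i ^ p = coordFun p k i := by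
  funext γ
  rw [Pi.pow_apply, coordFun, ← map_pow, ZMod.pow_card]

theorem linearIndependent_coordFun :
    LinearIndependent k (fun i : Fin d => coordFun p k i) := by
  rw [Fintype.linearIndependent_iff]
  intro c hc j
  have := congrFun hc (Pi.single j 1)
  rw [Finset.sum_apply, Finset.sum_eq_single j] at this
  · simpa [coordFun] using this
  · intro i _ hi
    simp [coordFun, Pi.single_eq_of_ne hi]
  · simp

theorem algHom_apply_eq_sum {Γ : Type*} [Fintype Γ] [DecidableEq Γ] {A : Type*} [CommRing A]
    [Algebra k A] (φ : (Γ → k) →ₐ[k] A) (h : Γ → k) :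
    φ h = ∑ γ, h γ • φ (Pi.single γ 1) := by
  conv_lhs => rw [← Finset.univ_sum_single h, map_sum]
  refine Finset.sum_congr rfl fun γ _ => ?_
  rw [← map_smul, ← Pi.single_smul, smul_eq_mul, mul_one]

/-- The delta functions are a partition of unity into joint eigenvectors of the coordinate
functions. Their images inherit this, and `eq_multiIndicator` gives uniqueness. -/
theorem algHom_single_eq {A : Type*} [CommRing A] [Algebra k A]
    (φ : ((Fin d → ZMod p) → k) →ₐ[k] A) (γ : Fin d → ZMod p) :
    φ (Pi.single γ 1) = multiIndicator (primeField p k A) (fun i => φ (coordFun p k i)) γ := by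
  refine eq_multiIndicator _ (fun i => by rw [← map_pow, coordFun_pow])
    (R := fun γ => φ (Pi.single γ 1)) (fun i γ => ?_) ?_ γ
  · rw [← map_mul, coordFun_mul_single, map_mul]
    congr 1
    simp [primeField]
  · rw [← map_sum]
    have : ∑ γ, Pi.single γ (1 : k) = (1 : (Fin d → ZMod p) → k) := by
      simpa using Finset.univ_sum_single (1 : (Fin d → ZMod p) → k)
    rw [this, map_one]

/-- The algebra homomorphism from functions on `(ℤ/p)^d` that sends the coordinate functions to
given elements with `f^p = f`. -/
noncomputable def algHomOfPow {A : Type*} [CommRing A] [Algebra k A] (f : Fin d → A)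
    (hf : ∀ i, f i ^ p = f i) : ((Fin d → ZMod p) → k) →ₐ[k] A :=
  AlgHom.ofLinearMap
    (∑ γ, (LinearMap.proj γ : ((Fin d → ZMod p) → k) →ₗ[k] k).smulRight
      (multiIndicator (primeField p k A) f γ))
    (by simp [LinearMap.sum_apply, sum_multiIndicator])
    (by
      intro x y
      have hzero : ∀ γ δ : Fin d → ZMod p, δ ≠ γ → multiIndicator (primeField p k A) f γ *
          multiIndicator (primeField p k A) f δ = 0 := fun γ δ hδ =>
        eigen_mul_eq_zero _ (fun i => mul_multiIndicator _ hf i γ)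
          (fun i => mul_multiIndicator _ hf i δ) hδ.symm
      -- Idempotency follows by multiplying the partition of unity by one indicator and dropping the
      -- orthogonal terms.
      have hone : ∀ γ, multiIndicator (primeField p k A) f γ *
          multiIndicator (primeField p k A) f γ = multiIndicator (primeField p k A) f γ := by
        intro γ
        have h := congrArg (fun t => multiIndicator (primeField p k A) f γ * t)
          (sum_multiIndicator (primeField p k A) f)
        simp only [Finset.mul_sum, mul_one] at h
        rwa [Finset.sum_eq_single γ (fun δ _ hδ => hzero γ δ hδ)
          fun h => absurd (Finset.mem_univ γ) h] at h
      simp only [LinearMap.sum_apply, LinearMap.smulRight_apply, LinearMap.proj_apply,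
        Finset.sum_mul_sum, smul_mul_smul_comm, Pi.mul_apply]
      refine Finset.sum_congr rfl fun γ _ => ?_
      rw [Finset.sum_eq_single γ, hone]
      · intro δ _ hδ
        rw [hzero γ δ hδ, smul_zero]
      · simp)

theorem algHomOfPow_apply {A : Type*} [CommRing A] [Algebra k A] (f : Fin d → A)
    (hf : ∀ i, f i ^ p = f i) (h : (Fin d → ZMod p) → k) :
    algHomOfPow (k := k) f hf h = ∑ γ, h γ • multiIndicator (primeField p k A) f γ := by
  simp [algHomOfPow, LinearMap.sum_apply]

theorem algHomOfPow_single {A : Type*} [CommRing A] [Algebra k A] (f : Fin d → A)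
    (hf : ∀ i, f i ^ p = f i) (γ : Fin d → ZMod p) :
    algHomOfPow (k := k) f hf (Pi.single γ 1) = multiIndicator (primeField p k A) f γ := by
  rw [algHomOfPow_apply, Finset.sum_eq_single γ]
  · simp
  · intro δ _ hδ
    simp [Pi.single_eq_of_ne hδ]
  · simp

theorem algHomOfPow_coordFun {A : Type*} [CommRing A] [Algebra k A] (f : Fin d → A)
    (hf : ∀ i, f i ^ p = f i) (i : Fin d) :
    algHomOfPow (k := k) f hf (coordFun p k i) = f i := by
  rw [algHomOfPow_apply, ← mul_one (f i), ← sum_multiIndicator (primeField p k A) f,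
    Finset.mul_sum]
  refine Finset.sum_congr rfl fun γ _ => ?_
  rw [mul_multiIndicator _ hf, Algebra.smul_def]
  rfl

variable (G : FinGroupScheme p k)

/-- The comultiplication as an algebra homomorphism. -/
noncomputable abbrev FinGroupScheme.comulHom : G.coord →ₐ[k] G.coord ⊗[k] G.coord :=
  Bialgebra.comulAlgHom k G.coord

/-- A homomorphism from `G` to the constant group scheme `ℤ/p`, as a function on `G`. -/
def FinGroupScheme.IsCharacter (f : G.coord) : Prop :=
  f ^ p = f ∧ Coalgebra.comul (R := k) f = f ⊗ₜ[k] 1 + 1 ⊗ₜ[k] f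

/-- Both sides are partitions of unity into joint eigenvectors of the elements `f i ⊗ 1 + 1 ⊗ f i`,
hence equal by `eq_multiIndicator`. -/
theorem comul_multiIndicator {f : Fin d → G.coord} (hf : ∀ i, G.IsCharacter (f i))
    (γ : Fin d → ZMod p) :
    Coalgebra.comul (R := k) (multiIndicator (primeField p k G.coord) f γ) =
      ∑ α, multiIndicator (primeField p k G.coord) f α ⊗ₜ[k]
        multiIndicator (primeField p k G.coord) f (γ - α) := by
  have hΔ : ∀ a, Coalgebra.comul (R := k) a = (G.comulHom : G.coord →+* _) a := fun a => rfl
  have hprime : (G.comulHom : G.coord →+* _).comp (primeField p k G.coord) =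
      primeField p k (G.coord ⊗[k] G.coord) := Subsingleton.elim _ _
  rw [hΔ, map_multiIndicator, hprime]
  symm
  have hl : ∀ c, (primeField p k G.coord c) ⊗ₜ[k] (1 : G.coord) =
      primeField p k (G.coord ⊗[k] G.coord) c := fun c => rfl
  have hr : ∀ c, (1 : G.coord) ⊗ₜ[k] (primeField p k G.coord c) =
      primeField p k (G.coord ⊗[k] G.coord) c := fun c =>
    (Algebra.TensorProduct.algebraMap_apply' (ZMod.castHom (dvd_refl p) k c)).symm
  refine eq_multiIndicator (primeField p k (G.coord ⊗[k] G.coord))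
    (fun i => by rw [← map_pow, (hf i).1])
    (R := fun γ => ∑ α, multiIndicator (primeField p k G.coord) f α ⊗ₜ[k]
        multiIndicator (primeField p k G.coord) f (γ - α)) (fun i γ => ?_) ?_ γ
  · rw [← hΔ, (hf i).2, Finset.mul_sum, Finset.mul_sum]
    refine Finset.sum_congr rfl fun α _ => ?_
    have e1 := mul_multiIndicator (primeField p k G.coord) (fun i => (hf i).1) i α
    have e2 := mul_multiIndicator (primeField p k G.coord) (fun i => (hf i).1) i (γ - α)
    rw [add_mul, Algebra.TensorProduct.tmul_mul_tmul, Algebra.TensorProduct.tmul_mul_tmul, e1, e2,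
      one_mul, one_mul]
    have e3 : primeField p k (G.coord ⊗[k] G.coord) (γ i) =
        primeField p k G.coord (α i) ⊗ₜ[k] 1 + 1 ⊗ₜ[k] primeField p k G.coord ((γ - α) i) := by
      rw [hl, hr, ← map_add, Pi.sub_apply, add_sub_cancel]
    rw [e3, add_mul, Algebra.TensorProduct.tmul_mul_tmul, Algebra.TensorProduct.tmul_mul_tmul,
      one_mul, one_mul]
  · rw [Finset.sum_comm]
    have : ∀ α : Fin d → ZMod p, ∑ γ, multiIndicator (primeField p k G.coord) f α ⊗ₜ[k]
        multiIndicator (primeField p k G.coord) f (γ - α) =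
        multiIndicator (primeField p k G.coord) f α ⊗ₜ[k] (1 : G.coord) := by
      intro α
      rw [← TensorProduct.tmul_sum, ← sum_multiIndicator (primeField p k G.coord) f]
      congr 1
      exact Fintype.sum_equiv (Equiv.subRight α) _ _ fun γ => rfl
    simp only [this]
    rw [← TensorProduct.sum_tmul, sum_multiIndicator, Algebra.TensorProduct.one_def]

/-- Coordinates are additive: writing `γ i = α i + (γ - α) i` splits the double sum into two parts,
and in each the free factor sums to `1`. -/
theorem isCharacter_of_homToConst (φ : G.HomToConst (Fin d → ZMod p)) (i : Fin d) :
    G.IsCharacter (φ.toAlgHom (coordFun p k i)) := by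
  refine ⟨by rw [← map_pow, coordFun_pow], ?_⟩
  rw [algHom_apply_eq_sum, map_sum]
  simp only [map_smul, φ.comul_single]
  have hone : ∑ γ, φ.toAlgHom (Pi.single γ 1) = 1 := by
    have := algHom_apply_eq_sum φ.toAlgHom 1
    simpa using this.symm
  have hsplit : ∀ γ : Fin d → ZMod p,
      coordFun p k i γ • ∑ α, φ.toAlgHom (Pi.single α 1) ⊗ₜ[k] φ.toAlgHom (Pi.single (γ - α) 1) =
      ∑ α, ((coordFun p k i α • φ.toAlgHom (Pi.single α 1)) ⊗ₜ[k]
          φ.toAlgHom (Pi.single (γ - α) 1) +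
        φ.toAlgHom (Pi.single α 1) ⊗ₜ[k]
          (coordFun p k i (γ - α) • φ.toAlgHom (Pi.single (γ - α) 1))) := by
    intro γ
    rw [Finset.smul_sum]
    refine Finset.sum_congr rfl fun α _ => ?_
    rw [TensorProduct.tmul_smul, ← TensorProduct.smul_tmul', ← add_smul]
    congr 1
    simp [coordFun]
  simp only [hsplit]
  rw [Finset.sum_comm]
  have hshift : ∀ α : Fin d → ZMod p,
      ∑ γ, ((coordFun p k i α • φ.toAlgHom (Pi.single α 1)) ⊗ₜ[k]
          φ.toAlgHom (Pi.single (γ - α) 1) +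
        φ.toAlgHom (Pi.single α 1) ⊗ₜ[k]
          (coordFun p k i (γ - α) • φ.toAlgHom (Pi.single (γ - α) 1))) =
      (coordFun p k i α • φ.toAlgHom (Pi.single α 1)) ⊗ₜ[k] 1 +
        φ.toAlgHom (Pi.single α 1) ⊗ₜ[k]
          (∑ γ, coordFun p k i γ • φ.toAlgHom (Pi.single γ 1)) := by
    intro α
    rw [Finset.sum_add_distrib, ← TensorProduct.tmul_sum, ← TensorProduct.tmul_sum]
    congr 2
    · rw [← hone]
      exact Fintype.sum_equiv (Equiv.subRight α) _ _ fun γ => rfl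
    · exact Fintype.sum_equiv (Equiv.subRight α) _ _ fun γ => rfl
  simp only [hshift]
  rw [Finset.sum_add_distrib, ← TensorProduct.sum_tmul, ← TensorProduct.sum_tmul, hone]

theorem homToConst_ext {Γ : Type*} [AddCommGroup Γ] [Fintype Γ] [DecidableEq Γ]
    {φ ψ : G.HomToConst Γ} (h : φ.toAlgHom = ψ.toAlgHom) : φ = ψ := by
  cases φ
  cases ψ
  subst h
  rfl

/-- Homomorphisms from `G` to `(ℤ/p)^d` are `d`-tuples of homomorphisms to `ℤ/p`. -/
noncomputable def homToConstEquiv :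
    G.HomToConst (Fin d → ZMod p) ≃ {f : Fin d → G.coord // ∀ i, G.IsCharacter (f i)} where
  toFun φ := ⟨fun i => φ.toAlgHom (coordFun p k i), isCharacter_of_homToConst G φ⟩
  invFun f := ⟨algHomOfPow f.1 fun i => (f.2 i).1, fun γ => by
    simp only [algHomOfPow_single]
    exact comul_multiIndicator G f.2 γ⟩
  left_inv φ := by
    refine homToConst_ext G (AlgHom.ext fun h => ?_)
    rw [algHom_apply_eq_sum φ.toAlgHom]
    simp only [algHom_single_eq]
    exact algHomOfPow_apply _ _ _
  right_inv f := Subtype.ext (funext fun i => algHomOfPow_coordFun f.1 (fun i => (f.2 i).1) i)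

/-- If the map on spectra is surjective, the kernel lies in every prime of the reduced ring `Γ → k`,
so it is zero. Conversely, `A` is integral over `k`, and lying over applies to an injective integral
map. -/
theorem comap_surjective_iff_injective {Γ : Type*} [Finite Γ] {A : Type*} [CommRing A] [Algebra k A]
    [Module.Finite k A] (φ : (Γ → k) →ₐ[k] A) :
    Function.Surjective (PrimeSpectrum.comap φ.toRingHom) ↔ Function.Injective φ := by
  constructor
  · intro h
    rw [injective_iff_map_eq_zero]
    intro a ha
    have hn : IsNilpotent a := by
      rw [← mem_nilradical, nilradical_eq_sInf, Submodule.mem_sInf]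
      intro P hP
      obtain ⟨Q, hQ⟩ := h ⟨P, hP⟩
      have : P = Q.asIdeal.comap φ.toRingHom := congrArg PrimeSpectrum.asIdeal hQ.symm
      rw [this, Ideal.mem_comap]
      change φ a ∈ Q.asIdeal
      rw [ha]
      exact Q.asIdeal.zero_mem
    exact hn.eq_zero
  · intro h
    refine RingHom.IsIntegral.comap_surjective ?_ h
    refine RingHom.IsIntegral.tower_top (algebraMap k (Γ → k)) φ.toRingHom ?_
    have : φ.toRingHom.comp (algebraMap k (Γ → k)) = algebraMap k A := φ.comp_algebraMap
    rw [this]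
    exact algebraMap_isIntegral_iff.2 inferInstance

theorem tmul_ne_zero_of_field {V W : Type*} [AddCommGroup V] [Module k V] [AddCommGroup W]
    [Module k W] {v : V} {w : W} (hv : v ≠ 0) (hw : w ≠ 0) : v ⊗ₜ[k] w ≠ 0 := by
  obtain ⟨f, hf, -⟩ := Submodule.exists_le_ker_of_notMem (K := k) (p := ⊥) (v := v) (by simpa)
  obtain ⟨e, he, -⟩ := Submodule.exists_le_ker_of_notMem (K := k) (p := ⊥) (v := w) (by simpa)
  intro h
  have := congrArg (fun t => TensorProduct.lid k k (TensorProduct.map f e t)) h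
  simp at this
  tauto

/-- `S` is the image of `G` in `(ℤ/p)^d`; it is a subgroup because `G` is a group scheme. -/
theorem exists_character_support (φ : G.HomToConst (Fin d → ZMod p)) :
    ∃ S : Submodule (ZMod p) (Fin d → ZMod p), ∀ γ, γ ∈ S ↔ φ.toAlgHom (Pi.single γ 1) ≠ 0 := by
  have hnt : Nontrivial G.coord := by
    obtain ⟨v, hv⟩ := G.order
    exact Module.nontrivial_of_finrank_pos (R := k) (by
      rw [hv]; exact pow_pos (Fact.out : p.Prime).pos v)
  have hadd : ∀ α β, φ.toAlgHom (Pi.single α 1) ≠ 0 → φ.toAlgHom (Pi.single β 1) ≠ 0 →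
      φ.toAlgHom (Pi.single (α + β) 1) ≠ 0 := by
    intro α β hα hβ h0
    have h := φ.comul_single (α + β)
    rw [h0, map_zero] at h
    -- Multiplying the coproduct of the image of `δ_{α+β}` by that of `δ_α`, tensored with `1`,
    -- leaves only the tensor of the images of `δ_α` and `δ_β`.
    have h2 := congrArg (fun t => (φ.toAlgHom (Pi.single α 1) ⊗ₜ[k] (1 : G.coord)) * t) h
    simp only [mul_zero, Finset.mul_sum, Algebra.TensorProduct.tmul_mul_tmul, one_mul,
      ← map_mul] at h2
    rw [Finset.sum_eq_single α] at h2
    · rw [← Pi.single_mul, mul_one, add_sub_cancel_left] at h2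
      exact tmul_ne_zero_of_field hα hβ h2.symm
    · intro δ _ hδ
      have : (Pi.single α 1 * Pi.single δ 1 : (Fin d → ZMod p) → k) = 0 := by
        funext γ
        by_cases hγ : γ = α
        · subst hγ; simp [Pi.single_eq_of_ne hδ.symm]
        · simp [Pi.single_eq_of_ne hγ]
      rw [this, map_zero, TensorProduct.zero_tmul]
    · simp
  -- Only positive multiples are treated here; `0 ∈ S` is then deduced from `p • γ = 0` for some `γ
  -- ∈ S`.
  have hsmul : ∀ (n : ℕ) α, φ.toAlgHom (Pi.single α 1) ≠ 0 →
      φ.toAlgHom (Pi.single ((n + 1) • α) 1) ≠ 0 := by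
    intro n α hα
    induction n with
    | zero => simpa using hα
    | succ n ih => rw [succ_nsmul]; exact hadd _ _ ih hα
  have hzero : φ.toAlgHom (Pi.single 0 1) ≠ 0 := by
    have h1 : ∑ γ, φ.toAlgHom (Pi.single γ 1) ≠ 0 := by
      have := algHom_apply_eq_sum φ.toAlgHom 1
      simp only [map_one, Pi.one_apply, one_smul] at this
      rw [← this]
      exact one_ne_zero
    obtain ⟨γ, -, hγ⟩ := Finset.exists_ne_zero_of_sum_ne_zero h1
    have h2 := hsmul (p - 1) γ hγ
    rw [Nat.sub_add_cancel (Fact.out : p.Prime).one_le] at h2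
    have h3 : p • γ = 0 := by
      funext i
      simp
    rwa [h3] at h2
  refine ⟨{ carrier := {γ | φ.toAlgHom (Pi.single γ 1) ≠ 0}
            add_mem' := fun ha hb => hadd _ _ ha hb
            zero_mem' := hzero
            smul_mem' := fun c α hα => ?_ }, fun γ => Iff.rfl⟩
  have hc : c • α = c.val • α := by
    funext i
    simp
  rw [Set.mem_ofPred_eq, hc]
  rcases h : c.val with _ | n
  · rw [zero_smul]; exact hzero
  · exact hsmul n α hα

theorem injective_iff_linearIndependent (φ : G.HomToConst (Fin d → ZMod p)) :
    Function.Injective φ.toAlgHom ↔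
      LinearIndependent k fun i => φ.toAlgHom (coordFun p k i) := by
  constructor
  · intro h
    have h' : LinearMap.ker φ.toAlgHom.toLinearMap = ⊥ := LinearMap.ker_eq_bot.2 h
    have h2 := (linearIndependent_coordFun (p := p) (k := k) (d := d)).map'
      φ.toAlgHom.toLinearMap h'
    exact h2
  · intro h
    obtain ⟨S, hS⟩ := exists_character_support G φ
    have hall : ∀ γ, φ.toAlgHom (Pi.single γ 1) ≠ 0 := by
      intro γ h0
      -- If the image misses `γ`, an `𝔽_p`-linear form `F` vanishes on `S` but not at `γ`. Viewed as
      -- a function, `F` is a combination of the coordinates and is killed by `φ`, so independence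
      -- makes all its coefficients zero.
      obtain ⟨F, hF, hFS⟩ := Submodule.exists_le_ker_of_notMem (p := S) (v := γ)
        (fun hγ => (hS γ).1 hγ h0)
      refine hF ?_
      have hFsum : ∀ δ, F δ = ∑ i, F (Pi.single i 1) * δ i := by
        intro δ
        conv_lhs => rw [← Finset.univ_sum_single δ, map_sum]
        refine Finset.sum_congr rfl fun i _ => ?_
        rw [← mul_one (δ i), ← smul_eq_mul, Pi.single_smul, map_smul, smul_eq_mul, smul_eq_mul,
          mul_one, mul_comm]
      have hcomb : ∑ i, (ZMod.castHom (dvd_refl p) k (F (Pi.single i 1))) •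
          φ.toAlgHom (coordFun p k i) = 0 := by
        simp only [← map_smul]
        rw [← map_sum, algHom_apply_eq_sum]
        refine Finset.sum_eq_zero fun δ _ => ?_
        by_cases hδ : δ ∈ S
        · have e : (∑ i, (ZMod.castHom (dvd_refl p) k (F (Pi.single i 1))) •
              coordFun p k i) δ = ZMod.castHom (dvd_refl p) k (F δ) := by
            rw [hFsum δ, map_sum, Finset.sum_apply]
            refine Finset.sum_congr rfl fun i _ => ?_
            rw [map_mul]
            rfl
          rw [e, show F δ = 0 from hFS hδ, map_zero, zero_smul]
        · rw [not_not.1 (fun hne => hδ ((hS δ).2 hne)), smul_zero]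
      have hc := Fintype.linearIndependent_iff.1 h _ hcomb
      rw [hFsum]
      refine Finset.sum_eq_zero fun i _ => ?_
      rw [(ZMod.castHom (dvd_refl p) k).injective ((hc i).trans (map_zero _).symm), zero_mul]
    rw [injective_iff_map_eq_zero]
    intro a ha
    funext γ
    have h1 : φ.toAlgHom (a * Pi.single γ 1) = 0 := by rw [map_mul, ha, zero_mul]
    have h2 : a * Pi.single γ 1 = a γ • Pi.single γ (1 : k) := by
      funext δ
      by_cases h : δ = γ
      · subst h; simp
      · simp [Pi.single_eq_of_ne h]
    rw [h2, map_smul] at h1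
    exact (smul_eq_zero.1 h1).resolve_right (hall γ)

/-- Surjective homomorphisms from `G` to `(ℤ/p)^d` are linearly independent `d`-tuples of
homomorphisms to `ℤ/p`. -/
theorem numSurj_eq_card (d : ℕ) :
    G.numSurj d = Nat.card {f : Fin d → G.coord //
      (∀ i, G.IsCharacter (f i)) ∧ LinearIndependent k f} := by
  refine Nat.card_congr ?_
  refine ((homToConstEquiv G).subtypeEquiv (q := fun f => LinearIndependent k f.1)
    fun φ => ?_).trans 
    (Equiv.subtypeSubtypeEquivSubtypeInter (fun f : Fin d → G.coord => ∀ i, G.IsCharacter (f i))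
      fun f => LinearIndependent k f)
  rw [comap_surjective_iff_injective, injective_iff_linearIndependent]
  rfl

end HomToConst

/-! ### Characters of `G` as the `F`-fixed vectors of the Dieudonné module. -/

section Dieudonne

variable {p : ℕ} [Fact p.Prime]

/-- Such vectors are in the image of the `m`-fold Verschiebung, which is additive, so the claim
reduces to coefficient `0`. -/
theorem wittVector_coeff_add_of_forall_lt {R : Type*} [CommRing R] {x y : WittVector p R} {m : ℕ}
    (hx : ∀ i < m, x.coeff i = 0) (hy : ∀ i < m, y.coeff i = 0) :
    (∀ i < m, (x + y).coeff i = 0) ∧ (x + y).coeff m = x.coeff m + y.coeff m := by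
  have e : x + y = WittVector.verschiebung^[m] (x.shift m + y.shift m) := by
    rw [iterate_map_add, ← WittVector.eq_iterate_verschiebung hx,
      ← WittVector.eq_iterate_verschiebung hy]
  refine ⟨fun i hi => ?_, ?_⟩
  · rw [e, WittVector.iterate_verschiebung_coeff_eq_zero _ hi]
  · have h := WittVector.iterate_verschiebung_coeff (x.shift m + y.shift m) m 0
    rw [zero_add] at h
    rw [e, h, WittVector.add_coeff_zero]
    rfl

theorem wittOfCovector_coeff {A : Type*} (a : ℕ → A) (N i : ℕ) :
    (wittOfCovector p a N).coeff i = a (N - i) := rfl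

/-- Covectors concentrated in degree `0` add componentwise. -/
theorem coeff_wittOfCovector_add {A : Type*} [CommRing A] {a b : ℕ → A} (ha : ∀ n, a (n + 1) = 0)
    (hb : ∀ n, b (n + 1) = 0) (n m : ℕ) :
    (wittOfCovector p a (n + m) + wittOfCovector p b (n + m)).coeff m = a n + b n := by
  have hv : ∀ {c : ℕ → A}, (∀ n, c (n + 1) = 0) → ∀ i < m,
      (wittOfCovector p c (n + m)).coeff i = 0 := by
    intro c hc i hi
    rw [wittOfCovector_coeff, show n + m - i = (n + m - i - 1) + 1 by omega, hc]
  rw [(wittVector_coeff_add_of_forall_lt (hv ha) (hv hb)).2, wittOfCovector_coeff,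
    wittOfCovector_coeff, Nat.add_sub_cancel]

theorem isCovectorSum_iff {A : Type*} [CommRing A] {a b c : ℕ → A} (ha : ∀ n, a (n + 1) = 0)
    (hb : ∀ n, b (n + 1) = 0) : IsCovectorSum p a b c ↔ ∀ n, a n + b n = c n := by
  simp only [IsCovectorSum, coeff_wittOfCovector_add ha hb, eventually_const]

/-- Covectors concentrated in degree `0` add like elements of the additive group, so being a
homomorphism means that the entry is primitive. -/
theorem isCovectorHom_iff {k : Type*} [Field k] (G : FinGroupScheme p k) {a : ℕ → G.coord}
    (ha : ∀ n, a (n + 1) = 0) :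
    G.IsCovectorHom a ↔ Coalgebra.comul (R := k) (a 0) = a 0 ⊗ₜ[k] 1 + 1 ⊗ₜ[k] a 0 := by
  have hcov : IsCovector a := by
    -- The tail from index `1` on is zero, so it already generates the zero ideal.
    refine ⟨1, 1, ?_⟩
    rw [pow_one, Ideal.zero_eq_bot, Ideal.span_eq_bot]
    rintro x ⟨n, hn, rfl⟩
    obtain ⟨m, rfl⟩ := Nat.exists_eq_add_of_le' (Set.mem_Ici.1 hn)
    exact ha m
  rw [FinGroupScheme.IsCovectorHom, isCovectorSum_iff (fun n => by rw [ha, TensorProduct.zero_tmul])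
    (fun n => by rw [ha, TensorProduct.tmul_zero])]
  refine ⟨fun h => (h.2 0).symm, fun h => ⟨hcov, fun n => ?_⟩⟩
  rcases n with _ | n
  · exact h.symm
  · rw [ha, map_zero, TensorProduct.zero_tmul, TensorProduct.tmul_zero, add_zero]

variable {k : Type*} [Field k] [CharP k p] [PerfectRing k p] {g : ℕ} {G : FinGroupScheme p k}
  {M : PqpDBT1 p k g}

/-- This keeps the higher Witt addition polynomials out of the argument: a fixed vector corresponds
to a covector with a single entry. -/
theorem PqpDBT1.V_eq_zero_of_F_eq (M : PqpDBT1 p k g) {x : Std k g} (h : M.F x = x) : M.V x = 0 :=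
  (M.ker_V x).2 ⟨x, h⟩

theorem DieudonneIso.toFun_zero (Φ : DieudonneIso G M) (n : ℕ) : Φ.toFun 0 n = 0 := by
  have := Φ.map_smul 0 0 n
  rwa [zero_smul, map_zero, zero_smul] at this

theorem DieudonneIso.toFun_succ (Φ : DieudonneIso G M) {x : Std k g} (h : M.V x = 0) (n : ℕ) :
    Φ.toFun x (n + 1) = 0 := by
  rw [← Φ.map_V, h, Φ.toFun_zero]

/-- The part of the Dieudonné module killed by `V` consists of the primitive functions on `G`. -/
noncomputable def DieudonneIso.kerV (Φ : DieudonneIso G M) : LinearMap.ker M.V →ₗ[k] G.coord where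
  toFun x := Φ.toFun x 0
  map_add' x y := ((isCovectorSum_iff (Φ.toFun_succ x.2) (Φ.toFun_succ y.2)).1
    (Φ.map_add x y) 0).symm
  map_smul' c x := by
    have := Φ.map_smul c x 0
    rwa [iterateFrobeniusEquiv_zero] at this

theorem DieudonneIso.kerV_injective (Φ : DieudonneIso G M) : Function.Injective Φ.kerV := by
  intro x y h
  refine Subtype.ext (Φ.injective (funext fun n => ?_))
  rcases n with _ | n
  · exact h
  · rw [Φ.toFun_succ x.2, Φ.toFun_succ y.2]

theorem DieudonneIso.isCharacter (Φ : DieudonneIso G M) {x : Std k g} (h : M.F x = x) :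
    G.IsCharacter (Φ.toFun x 0) := by
  refine ⟨by rw [← Φ.map_F, h], ?_⟩
  rw [← isCovectorHom_iff G (Φ.toFun_succ (M.V_eq_zero_of_F_eq h))]
  exact Φ.range_eq.le ⟨x, rfl⟩

/-- The covector `(…, 0, 0, f)` is a homomorphism because `f` is primitive, and is fixed by `F`
because `f ^ p = f` and `0 ^ p = 0`. -/
theorem DieudonneIso.exists_of_isCharacter (Φ : DieudonneIso G M) {f : G.coord}
    (hf : G.IsCharacter f) : ∃ x, M.F x = x ∧ Φ.toFun x 0 = f := by
  let a : ℕ → G.coord := fun n => Nat.casesOn n f fun _ => 0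
  obtain ⟨x, hx⟩ := Φ.range_eq.ge ((isCovectorHom_iff G (a := a) fun n => rfl).2 hf.2)
  refine ⟨x, Φ.injective (funext fun n => ?_), congrFun hx 0⟩
  rw [Φ.map_F, hx]
  rcases n with _ | n
  · exact hf.1
  · exact zero_pow (Fact.out : p.Prime).ne_zero

/-- The linearly independent `d`-tuples of vectors fixed by `F`. -/
def PqpDBT1.fixedFrames (M : PqpDBT1 p k g) (d : ℕ) : Set (Fin d → Std k g) :=
  {x | LinearIndependent k x ∧ ∀ i, M.F (x i) = x i}

/-- Surjective homomorphisms from `G` to `(ℤ/p)^d` in terms of the Dieudonné module of `G`. -/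
theorem DieudonneIso.numSurj_eq (Φ : DieudonneIso G M) (d : ℕ) :
    G.numSurj d = Nat.card (M.fixedFrames d) := by
  rw [numSurj_eq_card]
  have hli : ∀ x : Fin d → Std k g, (∀ i, M.F (x i) = x i) →
      (LinearIndependent k (fun i => Φ.toFun (x i) 0) ↔ LinearIndependent k x) := by
    intro x hx
    let y : Fin d → LinearMap.ker M.V := fun i => ⟨x i, M.V_eq_zero_of_F_eq (hx i)⟩
    have h1 : LinearIndependent k (fun i => Φ.toFun (x i) 0) ↔ LinearIndependent k y :=
      LinearMap.linearIndependent_iff Φ.kerV (v := y) (LinearMap.ker_eq_bot.2 Φ.kerV_injective)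
    have h2 : LinearIndependent k x ↔ LinearIndependent k y :=
      LinearMap.linearIndependent_iff (LinearMap.ker M.V).subtype (v := y)
        (Submodule.ker_subtype _)
    rw [h1, h2]
  refine (Nat.card_congr (Equiv.ofBijective (fun x : M.fixedFrames d =>
    (⟨fun i => Φ.toFun (x.1 i) 0, fun i => Φ.isCharacter (x.2.2 i), (hli _ x.2.2).2 x.2.1⟩ :
      {f : Fin d → G.coord // (∀ i, G.IsCharacter (f i)) ∧ LinearIndependent k f}))
    ⟨?_, ?_⟩)).symm
  · intro x y h
    refine Subtype.ext (funext fun i => ?_)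
    have hi := congrFun (congrArg Subtype.val h) i
    have := Φ.kerV_injective (a₁ := ⟨x.1 i, M.V_eq_zero_of_F_eq (x.2.2 i)⟩)
      (a₂ := ⟨y.1 i, M.V_eq_zero_of_F_eq (y.2.2 i)⟩) hi
    exact congrArg Subtype.val this
  · rintro ⟨f, hf, hlin⟩
    choose x hx hxf using fun i => Φ.exists_of_isCharacter (hf i)
    obtain rfl : (fun i => Φ.toFun (x i) 0) = f := funext hxf
    exact ⟨⟨x, (hli x hx).1 hlin, hx⟩, rfl⟩

end Dieudonne

/-! ### Counting by equivariance under the symplectic group. -/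

/-- If all fibres of a map of finite sets have the same size, then preimages have the expected
size. -/
theorem card_preimage_mul {X Y : Type*} [Finite X] [Finite Y] (f : X → Y)
    (h : ∀ y y', ∃ e : X ≃ X, ∀ x, f x = y ↔ f (e x) = y') (S : Set Y) :
    Nat.card {x // f x ∈ S} * Nat.card Y = Nat.card S * Nat.card X := by
  classical
  have := Fintype.ofFinite Y
  rcases isEmpty_or_nonempty Y with hY | ⟨⟨y₀⟩⟩
  · simp
  have hc : ∀ y, Nat.card {x // f x = y} = Nat.card {x // f x = y₀} := by
    intro y
    obtain ⟨e, he⟩ := h y y₀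
    exact Nat.card_congr (e.subtypeEquiv he)
  have h1 : Nat.card X = Nat.card Y * Nat.card {x // f x = y₀} := by
    rw [← Nat.card_congr (Equiv.sigmaFiberEquiv f), Nat.card_sigma]
    simp [hc]
  have h2 : Nat.card {x // f x ∈ S} = Nat.card S * Nat.card {x // f x = y₀} := by
    rw [← Nat.card_congr (Equiv.sigmaSubtypeFiberEquivSubtype f (p := fun x => f x ∈ S)
      (q := fun y => y ∈ S) fun x => Iff.rfl), Nat.card_sigma]
    simp [hc]
  rw [h1, h2]
  ring

section Counting

variable {k : Type*} [Field k] [Finite k] {g : ℕ} {d : ℕ}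

variable (k g d) in
/-- The set of isotropic `d`-frames in `k^{2g}`. -/
abbrev IsotropicFrame : Type _ := {x : Fin d → Std k g // IsIsotropicFrame x}

theorem mulVec_injective (h : Sp k g) : Function.Injective fun x : Std k g => h.1 *ᵥ x := by
  intro x y hxy
  have e : (h⁻¹).1 * h.1 = 1 := congrArg Subtype.val (inv_mul_cancel h)
  simpa [Matrix.mulVec_mulVec, e] using congrArg (fun v => (h⁻¹).1 *ᵥ v) hxy

/-- The number of symplectic automorphisms taking a given isotropic frame to another one. -/
theorem card_sp_map_mul_card (u v : IsotropicFrame k g d) :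
    Nat.card {h : Sp k g // ∀ i, h.1 *ᵥ u.1 i = v.1 i} * Nat.card (IsotropicFrame k g d) =
      Nat.card (Sp k g) := by
  -- Left multiplication permutes the fibres of the orbit map `h ↦ h u` transitively, by Witt's
  -- theorem.
  have key := card_preimage_mul
    (fun h : Sp k g => (⟨fun i => h.1 *ᵥ u.1 i, u.2.mulVec h⟩ : IsotropicFrame k g d)) (by
      intro y y'
      obtain ⟨a, ha⟩ := y.2.exists_sp_map y'.2
      refine ⟨Equiv.mulLeft a, fun h => ?_⟩
      rw [Subtype.ext_iff, Subtype.ext_iff, funext_iff, funext_iff]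
      refine forall_congr' fun i => ?_
      simp only [Equiv.coe_mulLeft, Submonoid.coe_mul, ← Matrix.mulVec_mulVec, ← ha]
      exact (mulVec_injective a).eq_iff.symm) {v}
  rw [Nat.card_unique (α := ({v} : Set (IsotropicFrame k g d))), one_mul] at key
  rw [← key]
  congr 1
  refine Nat.card_congr (Equiv.subtypeEquivRight fun h => ?_)
  rw [Set.mem_singleton_iff, Subtype.ext_iff, funext_iff]

/-- The symplectic group acts on isotropic frames. -/
noncomputable def mulVecEquiv (h : Sp k g) : IsotropicFrame k g d ≃ IsotropicFrame k g d :=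
  Equiv.ofBijective (fun x => ⟨fun i => h.1 *ᵥ x.1 i, x.2.mulVec h⟩)
    (Finite.injective_iff_bijective.1 fun _ _ hxy => Subtype.ext (funext fun i =>
      mulVec_injective h (congrFun (congrArg Subtype.val hxy) i)))

/-- A fixed nontrivial combination of a random isotropic frame is a uniform nonzero vector. -/
theorem card_combination_mem_mul {c : Fin d → k} (hc : c ≠ 0) (S : Set {v : Std k g // v ≠ 0}) :
    Nat.card {x : IsotropicFrame k g d // ∃ v ∈ S, ∑ i, c i • x.1 i = v.1} *
      Nat.card {v : Std k g // v ≠ 0} = Nat.card S * Nat.card (IsotropicFrame k g d) := by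
  have hne : ∀ x : IsotropicFrame k g d, ∑ i, c i • x.1 i ≠ 0 := fun x h0 =>
    hc (funext (Fintype.linearIndependent_iff.1 x.2.1 c h0))
  have key := card_preimage_mul
    (fun x : IsotropicFrame k g d => (⟨∑ i, c i • x.1 i, hne x⟩ : {v : Std k g // v ≠ 0})) (by
      intro y y'
      obtain ⟨a, ha⟩ := exists_sp_map_of_ne_zero y.2 y'.2
      refine ⟨mulVecEquiv a, fun x => ?_⟩
      have e : ∑ i, c i • (mulVecEquiv a x).1 i = a.1 *ᵥ ∑ i, c i • x.1 i := by
        rw [← Matrix.mulVecLin_apply, map_sum]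
        simp only [map_smul, Matrix.mulVecLin_apply]
        rfl
      simp only [Subtype.ext_iff, e, ← ha]
      exact (mulVec_injective a).eq_iff.symm) S
  rw [← key]
  congr 1
  refine Nat.card_congr (Equiv.subtypeEquivRight fun x => ⟨?_, fun h => ⟨_, h, rfl⟩⟩)
  rintro ⟨v, hv, hxv⟩
  convert hv

end Counting

/-! ### The expectation as the proportion of good isotropic frames, and its bounds. -/

section Expectation

variable {p : ℕ} [Fact p.Prime] {k : Type*} [Field k] [Finite k] [CharP k p] [PerfectRing k p]
  {g : ℕ} (M : PqpDBT1 p k g) {d : ℕ}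

theorem PqpDBT1.V_F (x : Std k g) : M.V (M.F x) = 0 := (M.ker_V _).2 ⟨x, rfl⟩

theorem PqpDBT1.omega_F_F (x y : Std k g) : omega (M.F x) (M.F y) = 0 := by
  rw [M.omega_F, M.V_F, omega_zero_right, map_zero]

/-- `ker F = im V` is isotropic: for `x ∈ ker F`, `σ(ω(x, V z)) = ω(F x, z) = 0`. -/
theorem PqpDBT1.two_mul_finrank_ker_F_le : 2 * Module.finrank k (LinearMap.ker M.F) ≤ 2 * g := by
  refine two_mul_finrank_le_of_isotropic _ fun x hx y hy => ?_
  obtain ⟨z, rfl⟩ := (M.ker_F y).1 hy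
  have h := M.omega_F x z
  rw [show M.F x = 0 from hx, omega_zero_left] at h
  exact (map_eq_zero_iff _ (frobeniusEquiv k p).injective).1 h.symm

/-- The isotropic frames that remain linearly independent under `F`. -/
abbrev PqpDBT1.GoodFrame (M : PqpDBT1 p k g) (d : ℕ) : Type _ :=
  {x : IsotropicFrame k g d // LinearIndependent k fun i => M.F (x.1 i)}

theorem PqpDBT1.mem_fixedFrames_translate (h₁ h₂ : Sp k g) (x : Fin d → Std k g) :
    x ∈ (M.translate h₁ h₂).fixedFrames d ↔
      LinearIndependent k x ∧ ∀ i, h₁.1 *ᵥ M.F (h₂.1 *ᵥ x i) = x i := Iff.rfl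

/-- The map `x ↦ h₂ x` conjugates `h₁ F h₂` into `h₂ h₁ F`. -/
theorem PqpDBT1.card_fixedFrames_translate (h₁ h₂ : Sp k g) :
    Nat.card ((M.translate h₁ h₂).fixedFrames d) =
      Nat.card ((M.translate (h₂ * h₁) 1).fixedFrames d) := by
  have hli : ∀ (h : Sp k g) (x : Fin d → Std k g), LinearIndependent k x →
      LinearIndependent k fun i => h.1 *ᵥ x i := fun h x hx =>
    hx.map' (Matrix.mulVecLin h.1) (LinearMap.ker_eq_bot.2 (mulVec_injective h))
  refine Nat.card_congr
    { toFun := fun x => ⟨fun i => h₂.1 *ᵥ x.1 i, ?_⟩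
      invFun := fun y => ⟨fun i => (h₂⁻¹).1 *ᵥ y.1 i, ?_⟩
      left_inv := fun x => Subtype.ext (funext fun i => inv_mulVec h₂ _)
      right_inv := fun x => Subtype.ext (funext fun i => mulVec_inv h₂ _) }
  · obtain ⟨x, hx⟩ := x
    rw [mem_fixedFrames_translate] at hx ⊢
    refine ⟨hli _ _ hx.1, fun i => ?_⟩
    rw [Submonoid.coe_mul, ← Matrix.mulVec_mulVec, OneMemClass.coe_one, Matrix.one_mulVec, hx.2]
  · obtain ⟨y, hy⟩ := y
    rw [mem_fixedFrames_translate] at hy ⊢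
    refine ⟨hli _ _ hy.1, fun i => ?_⟩
    have h := hy.2 i
    rw [Submonoid.coe_mul, ← Matrix.mulVec_mulVec, OneMemClass.coe_one, Matrix.one_mulVec] at h
    rw [mulVec_inv]
    change h₁.1 *ᵥ M.F (y i) = (h₂⁻¹).1 *ᵥ y i
    rw [← inv_mulVec h₂ (h₁.1 *ᵥ M.F (y i)), h]

/-- The `y i` lie in `h (im F)`, which is isotropic, and `F (y i) = h⁻¹ (y i)` is independent along
with `y`. -/
theorem PqpDBT1.isotropic_of_mem_fixedFrames {h : Sp k g} {y : Fin d → Std k g}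
    (hy : y ∈ (M.translate h 1).fixedFrames d) :
    IsIsotropicFrame y ∧ (LinearIndependent k fun i => M.F (y i)) ∧
      ∀ i, h.1 *ᵥ M.F (y i) = y i := by
  rw [mem_fixedFrames_translate] at hy
  simp only [OneMemClass.coe_one, Matrix.one_mulVec] at hy
  have hiso : IsIsotropicFrame y := ⟨hy.1, fun i j => by
    rw [← hy.2 i, ← hy.2 j, omega_mulVec, M.omega_F_F]⟩
  refine ⟨hiso, ?_, hy.2⟩
  have h2 := (hiso.mulVec h⁻¹).1
  have e : (fun i => M.F (y i)) = fun i => (h⁻¹).1 *ᵥ y i := funext fun i => by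
    conv_rhs => rw [← hy.2 i]
    rw [inv_mulVec]
  rw [e]
  exact h2

/-- Double counting of pairs `(h, y)` with `y` fixed by `h F`: for each good frame `y`, the number
of `h` taking the isotropic frame `F y` to `y` does not depend on `y`. -/
theorem PqpDBT1.sum_card_fixedFrames_mul [Fintype (Sp k g)] :
    (∑ h : Sp k g, Nat.card ((M.translate h 1).fixedFrames d)) *
      Nat.card (IsotropicFrame k g d) = Nat.card (M.GoodFrame d) * Nat.card (Sp k g) := by
  classical
  have := Fintype.ofFinite (M.GoodFrame d)
  rw [← Nat.card_sigma]
  have e : (Σ h : Sp k g, (M.translate h 1).fixedFrames d) ≃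
      Σ x : M.GoodFrame d, {h : Sp k g // ∀ i, h.1 *ᵥ M.F (x.1.1 i) = x.1.1 i} :=
    { toFun := fun a => ⟨⟨⟨a.2.1, (M.isotropic_of_mem_fixedFrames a.2.2).1⟩,
        (M.isotropic_of_mem_fixedFrames a.2.2).2.1⟩, a.1,
        (M.isotropic_of_mem_fixedFrames a.2.2).2.2⟩
      invFun := fun b => ⟨b.2.1, b.1.1.1, (M.mem_fixedFrames_translate _ _ _).2 ⟨b.1.1.2.1, by
        simpa only [OneMemClass.coe_one, Matrix.one_mulVec] using b.2.2⟩⟩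
      left_inv := fun a => rfl
      right_inv := fun b => rfl }
  rw [Nat.card_congr e, Nat.card_sigma, Finset.sum_mul]
  have h : ∀ x : M.GoodFrame d,
      Nat.card {h : Sp k g // ∀ i, h.1 *ᵥ M.F (x.1.1 i) = x.1.1 i} *
        Nat.card (IsotropicFrame k g d) = Nat.card (Sp k g) := fun x =>
    card_sp_map_mul_card (⟨_, x.2, fun i j => M.omega_F_F _ _⟩ : IsotropicFrame k g d) x.1
  simp only [h, Finset.sum_const, Finset.card_univ, smul_eq_mul,
    Nat.card_eq_fintype_card (α := M.GoodFrame d)]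

/-- The expected number of linearly independent `d`-tuples fixed by a random Frobenius is the
probability that a random isotropic frame remains linearly independent under `F`. -/
theorem PqpDBT1.sum_card_fixedFrames_translate_mul [Fintype (Sp k g)] :
    (∑ h : Sp k g × Sp k g, Nat.card ((M.translate h.1 h.2).fixedFrames d)) *
      Nat.card (IsotropicFrame k g d) =
        Nat.card (M.GoodFrame d) * Nat.card (Sp k g × Sp k g) := by
  have h : ∀ b : Sp k g, ∑ a : Sp k g, Nat.card ((M.translate a b).fixedFrames d) =
      ∑ a : Sp k g, Nat.card ((M.translate a 1).fixedFrames d) := fun b => by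
    simp only [M.card_fixedFrames_translate _ b]
    exact Fintype.sum_equiv (Equiv.mulLeft b) _ _ fun a => rfl
  rw [Fintype.sum_prod_type_right]
  simp only [h, Finset.sum_const, Finset.card_univ, smul_eq_mul]
  rw [mul_assoc, M.sum_card_fixedFrames_mul, Nat.card_prod, Nat.card_eq_fintype_card (α := Sp k g)]
  ring

theorem PqpDBT1.exists_combination_of_not_good {x : IsotropicFrame k g d}
    (hx : ¬ LinearIndependent k fun i => M.F (x.1 i)) :
    ∃ c : Fin d → k, c ≠ 0 ∧ M.F (∑ i, c i • x.1 i) = 0 := by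
  rw [Fintype.linearIndependent_iff] at hx
  push Not at hx
  obtain ⟨c, hc, i, hi⟩ := hx
  -- `F` is `σ`-semilinear, so a relation among the `F (x i)` comes from the combination with
  -- coefficients `σ⁻¹(c i)`.
  refine ⟨fun i => (frobeniusEquiv k p).symm (c i), fun h => hi ?_, ?_⟩
  · have := congrFun h i
    simpa only [Pi.zero_apply, map_eq_zero_iff _ (frobeniusEquiv k p).symm.injective] using this
  · rw [map_sum, ← hc]
    refine Finset.sum_congr rfl fun i _ => ?_
    rw [LinearMap.map_smulₛₗ, RingHom.coe_coe, RingEquiv.apply_symm_apply]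

theorem PqpDBT1.card_ker_F_le : Nat.card (LinearMap.ker M.F) ≤ Nat.card k ^ g := by
  rw [Module.natCard_eq_pow_finrank (K := k)]
  have := M.two_mul_finrank_ker_F_le
  exact Nat.pow_le_pow_right Nat.card_pos (by omega)

theorem card_ne_zero_add_one {V : Type*} [AddCommGroup V] [Finite V] :
    Nat.card {v : V // v ≠ 0} + 1 = Nat.card V := by
  classical
  have := Fintype.ofFinite V
  rw [Nat.card_eq_fintype_card, Nat.card_eq_fintype_card, Fintype.card_subtype_compl,
    Fintype.card_subtype_eq]
  exact Nat.sub_add_cancel Fintype.card_pos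

/-- The probability that a given combination of a random isotropic frame is killed by `F`. -/
theorem PqpDBT1.card_combination_mul_le (hg : 0 < g) {c : Fin d → k} (hc : c ≠ 0) :
    Nat.card {x : IsotropicFrame k g d // M.F (∑ i, c i • x.1 i) = 0} * (Nat.card k ^ g + 1) ≤
      Nat.card (IsotropicFrame k g d) := by
  have key := card_combination_mem_mul (k := k) (g := g) hc {v | M.F v.1 = 0}
  have h1 : Nat.card {x : IsotropicFrame k g d // ∃ v ∈ {v : {v : Std k g // v ≠ 0} | M.F v.1 = 0},
      ∑ i, c i • x.1 i = v.1} =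
      Nat.card {x : IsotropicFrame k g d // M.F (∑ i, c i • x.1 i) = 0} := by
    refine Nat.card_congr (Equiv.subtypeEquivRight fun x =>
      ⟨?_, fun h => ⟨⟨_, fun h0 => ?_⟩, h, rfl⟩⟩)
    · rintro ⟨v, hv, hxv⟩
      rw [hxv]
      exact hv
    · exact hc (funext (Fintype.linearIndependent_iff.1 x.2.1 c h0))
  have h2 : Nat.card {v : {v : Std k g // v ≠ 0} | M.F v.1 = 0} + 1 ≤ Nat.card k ^ g := by
    refine le_trans (le_of_eq ?_) M.card_ker_F_le
    rw [← card_ne_zero_add_one (V := LinearMap.ker M.F)]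
    congr 1
    exact Nat.card_congr
      { toFun := fun v => ⟨⟨v.1.1, v.2⟩, fun h => v.1.2 (congrArg Subtype.val h)⟩
        invFun := fun v => ⟨⟨v.1.1, fun h => v.2 (Subtype.ext h)⟩, v.1.2⟩
        left_inv := fun v => rfl
        right_inv := fun v => rfl }
  have h3 : Nat.card {v : Std k g // v ≠ 0} + 1 = Nat.card k ^ g * Nat.card k ^ g := by
    rw [card_ne_zero_add_one, Nat.card_fun, ← pow_add]
    simp
  have hq : 1 < Nat.card k ^ g := Nat.one_lt_pow hg.ne' Finite.one_lt_card
  rw [h1] at key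
  -- With `Q = q^g - 1` there are `Q (Q + 2)` nonzero vectors, at most `Q` of them in `ker F`; `g >
  -- 0` allows `Q` to be cancelled.
  obtain ⟨Q, hQ⟩ : ∃ Q, Nat.card k ^ g = Q + 1 := ⟨_, (Nat.sub_add_cancel hq.le).symm⟩
  rw [hQ] at h2 h3 hq ⊢
  have h3' : Nat.card {v : Std k g // v ≠ 0} = Q * (Q + 1 + 1) := by
    have : (Q + 1) * (Q + 1) = Q * (Q + 1 + 1) + 1 := by ring
    omega
  rw [h3'] at key
  have h2' := Nat.le_of_succ_le_succ h2
  refine le_of_mul_le_mul_left (a := Q) ?_ (by omega)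
  calc _ = _ := by rw [mul_left_comm, key]
    _ ≤ _ := Nat.mul_le_mul_right _ h2'

/-- Most isotropic frames remain linearly independent under `F`. -/
theorem PqpDBT1.card_isotropicFrame_mul_le (hg : 0 < g) :
    Nat.card (IsotropicFrame k g d) * (Nat.card k ^ g + 1) ≤
      Nat.card (M.GoodFrame d) * (Nat.card k ^ g + 1) +
        Nat.card k ^ d * Nat.card (IsotropicFrame k g d) := by
  classical
  have := Fintype.ofFinite k
  have := Fintype.ofFinite (IsotropicFrame k g d)
  -- A union bound over all `q^d` coefficient vectors; the set for `c = 0` is empty by definition.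
  let bad : (Fin d → k) → Finset (IsotropicFrame k g d) := fun c =>
    Finset.univ.filter fun x => c ≠ 0 ∧ M.F (∑ i, c i • x.1 i) = 0
  have hbad : ∀ c, (bad c).card * (Nat.card k ^ g + 1) ≤ Nat.card (IsotropicFrame k g d) := by
    intro c
    by_cases hc : c = 0
    · simp [bad, hc]
    · refine le_of_eq_of_le ?_ (M.card_combination_mul_le hg hc)
      rw [Nat.subtype_card (bad c) fun x => by simp [bad, hc]]
  have hcover : (Finset.univ : Finset (IsotropicFrame k g d)) ⊆
      (Finset.univ.filter fun x => LinearIndependent k fun i => M.F (x.1 i)) ∪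
        Finset.univ.biUnion bad := by
    intro x _
    by_cases hx : LinearIndependent k fun i => M.F (x.1 i)
    · simp [hx]
    · obtain ⟨c, hc⟩ := M.exists_combination_of_not_good hx
      exact Finset.mem_union_right _ (Finset.mem_biUnion.2 ⟨c, Finset.mem_univ _,
        Finset.mem_filter.2 ⟨Finset.mem_univ _, hc⟩⟩)
  have hcard : Nat.card (IsotropicFrame k g d) ≤
      Nat.card (M.GoodFrame d) + ∑ c, (bad c).card := by
    rw [Nat.card_eq_fintype_card, ← Finset.card_univ, Nat.subtype_card
      (Finset.univ.filter fun x : IsotropicFrame k g d => LinearIndependent k fun i => M.F (x.1 i))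
      fun x => by simp]
    exact (Finset.card_le_card hcover).trans ((Finset.card_union_le _ _).trans
      (Nat.add_le_add_left Finset.card_biUnion_le _))
  calc _ ≤ _ := Nat.mul_le_mul_right _ hcard
    _ = Nat.card (M.GoodFrame d) * (Nat.card k ^ g + 1) +
        ∑ c, (bad c).card * (Nat.card k ^ g + 1) := by rw [add_mul, Finset.sum_mul]
    _ ≤ _ := by
      refine Nat.add_le_add_left ((Finset.sum_le_sum fun c _ => hbad c).trans (le_of_eq ?_)) _
      rw [Finset.sum_const, Finset.card_univ, ← Nat.card_eq_fintype_card, Nat.card_fun]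
      simp

/-- For `d ≤ g` isotropic frames exist, so the expectation is a genuine proportion of them; this
gives the upper bound, and the union bound gives the lower one. -/
theorem expectation_card_fixedFrames_mem_Icc (D₀ : PqpDieudonne p k g) (hg : 0 < g) (hd : d ≤ g) :
    expectation D₀ (fun M => (Nat.card (M.fixedFrames d) : ℝ)) ∈
      Set.Icc (1 - (Nat.card k : ℝ) ^ d * ((Nat.card k : ℝ) ^ g + 1)⁻¹) 1 := by
  have := Fintype.ofFinite (Sp k g)
  have hB : 0 < (Nat.card (IsotropicFrame k g d) : ℝ) := by
    obtain ⟨x, hx⟩ := exists_isIsotropicFrame (k := k) hd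
    have : Nonempty (IsotropicFrame k g d) := ⟨⟨x, hx⟩⟩
    exact_mod_cast Nat.card_pos
  have hS : 0 < (Nat.card (Sp k g × Sp k g) : ℝ) := by exact_mod_cast Nat.card_pos
  have h1 : expectation D₀ (fun M => (Nat.card (M.fixedFrames d) : ℝ)) =
      Nat.card (D₀.reduce.GoodFrame d) / Nat.card (IsotropicFrame k g d) := by
    rw [expectation, finsum_eq_sum_of_fintype, div_eq_div_iff hS.ne' hB.ne']
    exact_mod_cast D₀.reduce.sum_card_fixedFrames_translate_mul (d := d)
  have hle : (Nat.card (D₀.reduce.GoodFrame d) : ℝ) ≤ Nat.card (IsotropicFrame k g d) := by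
    exact_mod_cast Nat.card_le_card_of_injective _ Subtype.val_injective
  have hmain : (Nat.card (IsotropicFrame k g d) : ℝ) * ((Nat.card k : ℝ) ^ g + 1) ≤
      Nat.card (D₀.reduce.GoodFrame d) * ((Nat.card k : ℝ) ^ g + 1) +
        (Nat.card k : ℝ) ^ d * Nat.card (IsotropicFrame k g d) := by
    exact_mod_cast D₀.reduce.card_isotropicFrame_mul_le (d := d) hg
  have hq : (0 : ℝ) < (Nat.card k : ℝ) ^ g + 1 := by positivity
  rw [h1]
  refine ⟨?_, (div_le_one hB).2 hle⟩
  rw [le_div_iff₀ hB, ← mul_le_mul_iff_left₀ hq]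
  have e : (1 - (Nat.card k : ℝ) ^ d * ((Nat.card k : ℝ) ^ g + 1)⁻¹) *
      Nat.card (IsotropicFrame k g d) * ((Nat.card k : ℝ) ^ g + 1) =
      Nat.card (IsotropicFrame k g d) * ((Nat.card k : ℝ) ^ g + 1) -
        (Nat.card k : ℝ) ^ d * Nat.card (IsotropicFrame k g d) := by
    field_simp
  rw [e]
  linarith

end Expectation

end RandomDieudonne

theorem mainTheorem7 (p : ℕ) [Fact p.Prime] (k : Type*) [Field k] [Finite k] [CharP k p]
    (d : ℕ)
    (D₀ : ∀ g : ℕ, RandomDieudonne.PqpDieudonne p k g)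
    (G : ∀ g : ℕ, RandomDieudonne.PqpDBT1 p k g → RandomDieudonne.FinGroupScheme p k)
    (hG : ∀ (g : ℕ) (M : RandomDieudonne.PqpDBT1 p k g),
      Nonempty (RandomDieudonne.DieudonneIso (G g M) M)) :
    Tendsto (fun g : ℕ =>
        RandomDieudonne.expectation (D₀ g) (fun M => ((G g M).numSurj d : ℝ)))
      atTop (𝓝 1) := by
  have hnum : ∀ g (M : RandomDieudonne.PqpDBT1 p k g),
      (G g M).numSurj d = Nat.card (M.fixedFrames d) := fun g M =>
    (hG g M).some.numSurj_eq d
  simp only [hnum]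
  have hq : Tendsto (fun g : ℕ => (Nat.card k : ℝ) ^ g + 1) atTop atTop :=
    tendsto_atTop_add_const_right _ _
      (tendsto_pow_atTop_atTop_of_one_lt (by exact_mod_cast Finite.one_lt_card))
  have hlim := (tendsto_const_nhds (x := (1 : ℝ))).sub
    (hq.inv_tendsto_atTop.const_mul ((Nat.card k : ℝ) ^ d))
  rw [mul_zero, sub_zero] at hlim
  refine tendsto_of_tendsto_of_tendsto_of_le_of_le' hlim tendsto_const_nhds ?_ ?_
  -- `g ≥ d + 1` provides both `0 < g` and `d ≤ g`.
  · filter_upwards [eventually_ge_atTop (d + 1)] with g hg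
    exact (RandomDieudonne.expectation_card_fixedFrames_mem_Icc (D₀ g) (by omega) (by omega)).1
  · filter_upwards [eventually_ge_atTop (d + 1)] with g hg
    exact (RandomDieudonne.expectation_card_fixedFrames_mem_Icc (D₀ g) (by omega) (by omega)).2
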